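/- **Setting.** Consider the following queueing system with two cells and a fixed threshold $\theta\in[0,\infty)$. Messages arrive according to a Poisson process of rate $\lambda>0$; their service times are i.i.d., independent of the arrivals, with distribution function $G$ of a random variable $\sigma>0$ with $\mathbb{E}\sigma<\infty$. Cell 1 holds the message in service (service rate one), cell 2 a waiting message. A message that arrives when the system is empty, or when the message in cell 1 has received at most $\theta$ units of service, enters cell 1 (pushing out the message there, if any); otherwise it enters cell 2 (pushing out the message there, if any). When a service is completed the message in cell 1 departs, and the waiting message, if any, moves to cell 1. The system is in steady state on the whole time axis. Let $\cdots<S_{-1}<S_0\le 0<S_1<\cdots$ be the departure times of the successfully served messages, $K_n$ the number of messages in the system immediately after $S_n$, and $\alpha(t)=t-A(t)$ the age of information, where $A(t)$ is the largest arrival time among the messages completely served up to time $t$ (inclusive, so that a message departing at $t$ counts). Let $\mathbb{P}^0,\mathbb{E}^0$ be the Palm probability and expectation with respect to the departures $(S_n)$ (so $S_0=0$, $\mathbb{P}^0$-a.s.). Put $$q=1-\int_0^\infty e^{-\lambda(\theta\wedge x)}\,dG(x),\qquad \hat J(s)=\int_0^\infty e^{-sy}\,dJ(y),$$ where $J$ is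 the probability law with $dJ(y)=q^{-1}\lambda e^{-\lambda y}(1-G(y))\,dy$ on $0\le y<\theta$ if $\theta>0$, and $J=\delta_0$ if $\theta=0$ (then $q=0$). Assume $\mathbb{P}(\sigma>\theta)>0$ and put $$dF_1(x)=\frac{(e^{-\lambda\theta}-e^{-\lambda x})\,dG(x)}{\int_\theta^\infty(e^{-\lambda\theta}-e^{-\lambda z})\,dG(z)}\quad(x>\theta),\qquad \hat F_1(s)=\int_\theta^\infty e^{-sx}\,dF_1(x).$$ **Lemma.** The event $\{K_{-1}=0,\,K_0=1\}$ has positive probability under $\mathbb{P}^0$, and for every real $s\ge 0$ $$\mathbb{E}^0\big(e^{-s(S_0-S_{-1})}\,\big|\,K_{-1}=0,K_0=1\big)=\frac{\lambda}{\lambda+s}\cdot\frac{1-q}{1-q\hat J(s)}\,\hat F_1(s),$$ $$\mathbb{E}^0\big(e^{-s\alpha(S_0)}\,\big|\,K_{-1}=0,K_0=1\big)=\hat F_1(s).$$ -/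

import Mathlib

open MeasureTheory ProbabilityTheory Set Filter

noncomputable section

namespace AoI

/-- Content of the two-cell buffer. A message in cell 1 is described by its age (time since its
arrival), the amount of service it has received, and the service time it requires; a message in
cell 2 by its age and the service time it requires. -/
inductive State where
  /-- no message in the system -/
  | empty : State
  /-- one message, in service -/
  | one (age served need : ℝ) : State
  /-- one message in service (first three entries) and one waiting message (last two entries) -/
  | two (age served need age' need' : ℝ) : State

namespace State

/-- The state as an element of a disjoint union of powers of the real line. -/
def code : State → Unit ⊕ (ℝ × ℝ × ℝ) ⊕ (ℝ × ℝ × ℝ × ℝ × ℝ)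
  | empty => .inl ()
  | one a u r => .inr (.inl (a, u, r))
  | two a u r a' r' => .inr (.inr (a, u, r, a', r'))

instance : MeasurableSpace State := MeasurableSpace.comap code inferInstance

/-- Number of messages in the system. -/
def count : State → ℕ
  | empty => 0
  | one _ _ _ => 1
  | two _ _ _ _ _ => 2

/-- Evolution during a time span of length `h` without arrivals: service at unit rate; on
completion the message in cell 1 leaves and a waiting message, if any, enters cell 1. -/
def advance (h : ℝ) : State → State
  | empty => empty
  | one a u r => if u + h < r then one (a + h) (u + h) r else empty
  | two a u r a' r' =>
      if u + h < r then two (a + h) (u + h) r (a' + h) r'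
      else if u + h - r < r' then one (a' + h) (u + h - r) r' else empty

/-- Effect of the arrival of a message with required service time `x`. If the message in cell 1
has received at most `θ` units of service, it is pushed out and replaced by the new message;
otherwise the new message occupies cell 2, pushing out the message there, if any. -/
def arrive (θ x : ℝ) : State → State
  | empty => one 0 0 x
  | one a u r => if u ≤ θ then one 0 0 x else two a u r 0 x
  | two a u r a' r' => if u ≤ θ then two 0 0 x a' r' else two a u r 0 x

/-- Starting from the given state and in the absence of arrivals, a message completes its service
after exactly `h` units of time, and its age is then `b`. -/
def Completes (h b : ℝ) : State → Prop
  | empty => False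
  | one a u r => u + h = r ∧ b = a + h
  | two a u r a' r' => (u + h = r ∧ b = a + h) ∨ (u + h = r + r' ∧ b = a' + h)

end State

/-- At time `t` a message that arrived at time `a` completes its service and departs. Here `arr`
is the sequence of arrival times and `state` the (right-continuous) state trajectory. -/
def Departs (arr : ℤ → ℝ) (state : ℝ → State) (t a : ℝ) : Prop :=
  ∃ n : ℤ, arr n < t ∧ t ≤ arr (n + 1) ∧ (state (arr n)).Completes (t - arr n) (t - a)

/-- The arrivals after time `0`: the time from `0` to the first arrival, then the successive
interarrival times, each together with the service time of the message that arrives at the end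
of that interval. -/
def future {Ω : Type*} (arr svc : ℤ → Ω → ℝ) (ω : Ω) (n : ℕ) : ℝ × ℝ :=
  (if n = 0 then arr 1 ω else arr (n + 1) ω - arr n ω, svc (n + 1) ω)

/-- The two-cell system with preemption threshold `θ`, Poisson arrivals of rate `lam` and i.i.d.
service times with law `G`, in steady state on the whole time axis. As usual in Palm calculus,
stationarity is expressed by a measure-preserving flow `flow t` (time shift by `t`) with which all
the stochastic objects are compatible. -/
structure StationarySystem {Ω : Type*} [MeasurableSpace Ω] (P : Measure Ω)
    (lam : ℝ) (G : Measure ℝ) (θ : ℝ) where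
  /-- time shifts -/
  flow : ℝ → Ω → Ω
  /-- arrival times -/
  arr : ℤ → Ω → ℝ
  /-- required service time of the message that arrives at `arr n` -/
  svc : ℤ → Ω → ℝ
  /-- state of the system at each time, right-continuous -/
  state : ℝ → Ω → State
  /-- departure times of successfully served messages -/
  dep : ℤ → Ω → ℝ
  measurable_flow : Measurable fun p : ℝ × Ω => flow p.1 p.2
  flow_zero : ∀ ω, flow 0 ω = ω
  flow_add : ∀ t u ω, flow (t + u) ω = flow t (flow u ω)
  measurePreserving_flow : ∀ t, MeasurePreserving (flow t) P P
  measurable_arr : ∀ n, Measurable (arr n)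
  measurable_svc : ∀ n, Measurable (svc n)
  measurable_state : Measurable (state 0)
  measurable_dep : ∀ n, Measurable (dep n)
  arr_strictMono : ∀ ω, StrictMono fun n => arr n ω
  arr_zero_nonpos : ∀ ω, arr 0 ω ≤ 0
  arr_one_pos : ∀ ω, 0 < arr 1 ω
  arr_atTop : ∀ ω, Tendsto (fun n => arr n ω) atTop atTop
  arr_atBot : ∀ ω, Tendsto (fun n => arr n ω) atBot atBot
  svc_pos : ∀ n ω, 0 < svc n ω
  /-- the marked arrival process is compatible with the time shifts -/
  arr_flow : ∀ t ω, ∃ k : ℤ, ∀ n,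
    arr n (flow t ω) = arr (n + k) ω - t ∧ svc n (flow t ω) = svc (n + k) ω
  /-- arrivals after time `0`: independent exponential waiting times of rate `lam` and independent
  service times of law `G`, independent of each other -/
  future_law : P.map (future arr svc) =
    Measure.infinitePi fun _ : ℕ => (expMeasure lam).prod G
  /-- arrivals after time `0` are independent of the past arrivals and of the state at time `0` -/
  indep_future : IndepFun
    (fun ω => (state 0 ω, fun n : ℕ => (arr (-(n : ℤ)) ω, svc (-(n : ℤ)) ω)))
    (future arr svc) P
  /-- the state is compatible with the time shifts -/
  state_flow : ∀ t u ω, state u (flow t ω) = state (u + t) ω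
  /-- the state between two arrivals -/
  state_between : ∀ n t ω, arr n ω ≤ t → t < arr (n + 1) ω →
    state t ω = (state (arr n ω) ω).advance (t - arr n ω)
  /-- the state at an arrival -/
  state_arrival : ∀ n ω, state (arr (n + 1) ω) ω =
    ((state (arr n ω) ω).advance (arr (n + 1) ω - arr n ω)).arrive θ (svc (n + 1) ω)
  /-- `dep` enumerates the departure times in increasing order -/
  dep_strictMono : ∀ ω, StrictMono fun n => dep n ω
  dep_zero_nonpos : ∀ ω, dep 0 ω ≤ 0
  dep_one_pos : ∀ ω, 0 < dep 1 ω
  range_dep : ∀ ω, range (fun n => dep n ω) =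
    {t | ∃ a, Departs (fun n => arr n ω) (fun u => state u ω) t a}

namespace StationarySystem

variable {Ω : Type*} [MeasurableSpace Ω] {P : Measure Ω} {lam : ℝ} {G : Measure ℝ} {θ : ℝ}

/-- Number of messages in the system immediately after the `n`-th departure. -/
def numLeft (X : StationarySystem P lam G θ) (n : ℤ) (ω : Ω) : ℕ :=
  (X.state (X.dep n ω) ω).count

/-- Age of information at time `t`: time elapsed since the largest arrival time among the messages
completely served up to time `t`. -/
def age (X : StationarySystem P lam G θ) (t : ℝ) (ω : Ω) : ℝ :=
  t - sSup {a | ∃ t' ≤ t, Departs (fun n => X.arr n ω) (fun u => X.state u ω) t' a}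

/-- Intensity of the departures: mean number of departures in the time interval `(0, 1]`. -/
def intensity (X : StationarySystem P lam G θ) : ENNReal :=
  ∑' n : ℤ, P {ω | 0 < X.dep n ω ∧ X.dep n ω ≤ 1}

/-- Palm probability of the departure process:
`A ↦ E[#{n : 0 < dep n ≤ 1, flow (dep n) ω ∈ A}] / intensity`. -/
def palm (X : StationarySystem P lam G θ) : Measure Ω :=
  X.intensity⁻¹ • Measure.sum fun n : ℤ =>
    (P.restrict {ω | 0 < X.dep n ω ∧ X.dep n ω ≤ 1}).map fun ω => X.flow (X.dep n ω) ω

end StationarySystem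

/-- Laplace transform of a measure on the real line. -/
def laplace (m : Measure ℝ) (s : ℝ) : ℝ := ∫ x, Real.exp (-s * x) ∂m

/-- The probability `q` that a service is preempted, defined by
`1 - q = ∫ exp (-lam * min θ x) dG(x)`. -/
def preemptProb (lam : ℝ) (G : Measure ℝ) (θ : ℝ) : ℝ :=
  1 - ∫ x, Real.exp (-lam * min θ x) ∂G

/-- The law `J`: distribution function equal to `1` on `[θ, ∞)`, and
`dJ(y) = q⁻¹ lam exp (-lam y) (1 - G(y)) dy` for `0 ≤ y < θ`. For `θ = 0` this is the unit mass
at `0`. -/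
def lawJ (lam : ℝ) (G : Measure ℝ) (θ : ℝ) : Measure ℝ :=
  if θ = 0 then Measure.dirac 0
  else (volume.restrict (Ico 0 θ)).withDensity fun y =>
    ENNReal.ofReal ((preemptProb lam G θ)⁻¹ * (lam * Real.exp (-lam * y) * (1 - G.real (Iic y))))

/-- The law `F₁` on `(θ, ∞)`, with density proportional to `exp (-lam θ) - exp (-lam x)` with
respect to `G`. -/
def lawF1 (lam : ℝ) (G : Measure ℝ) (θ : ℝ) : Measure ℝ :=
  (G.restrict (Ioi θ)).withDensity fun x =>
    ENNReal.ofReal ((Real.exp (-lam * θ) - Real.exp (-lam * x)) /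
      ∫ z in Ioi θ, (Real.exp (-lam * θ) - Real.exp (-lam * z)) ∂G)

end AoI

end

/-!
A cycle that starts with an empty system consists of an idle period `I`, a run of messages that are
preempted, and a completed service. Seen from the arrival that ends the idle period, everything is
a function of the independent pairs (service requirement, time to the next arrival): a service of
requirement `r`, followed by an arrival after a time `T`, is preempted if `T ≤ θ` and `T < r`;
otherwise it is completed, and it leaves a message behind exactly if `T ≤ r`. The mean weight of a
cycle is therefore a geometric series (`lintegral_mul_cycleWeight`), with ratio `q * Ĵ(s)`
(`restartFactor_toReal`) and with a last factor proportional to `F̂₁(s)` (`laplace_lawF1`). That the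
trajectories behave in this way is `StationarySystem.first_departure_of_empty`.

Independence of past and future is available only at time `0`, not at departures. The two are
connected by the inversion formula `StationarySystem.lintegral_eq_lintegral_palmSum`: a stationary
expectation `E Φ` is the integral, under the Palm measure before normalisation, of
`∫ Φ (flow t ω) dt` over the preceding interdeparture interval. It is applied to
`Φ = 1{empty at time 0} * s * exp (-s * arr 1) * weight`. On the stationary side, the time to the
next arrival and the weight of the cycle are independent. On the Palm side, the integral over the
idle period is `(1 - exp (-s * I)) * weight`. Letting `s` tend to infinity gives the Palm integral
of `weight`, and a subtraction that of `exp (-s * I) * weight`; both claims are quotients of such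
integrals.

The Palm measure can be normalised because the intensity of the departures is finite
(`StationarySystem.intensity_ne_top`), and the conditioning event has positive probability because
the stationary system is empty with positive probability
(`StationarySystem.measure_state_eq_empty_ne_zero`). For the age of information one also needs that
no message served earlier carries a later arrival time. This is not built into the recursion for the
state, which allows a message that has been waiting since the infinite past, but it holds almost
surely, since interarrival times greater than `θ` occur arbitrarily early
(`StationarySystem.ae_hasLongGaps`, `StationarySystem.le_of_departsAt`).
-/

namespace AoI

open scoped ENNReal

/-! ### The weight of a cycle as a function of the arrivals -/

/-- The sequence with the given first entry and the given tail. -/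
def consSeq {α : Type*} (p : α × (ℕ → α)) : ℕ → α
  | 0 => p.1
  | n + 1 => p.2 n

lemma measurable_consSeq {α : Type*} [MeasurableSpace α] :
    Measurable (consSeq : α × (ℕ → α) → ℕ → α) := by
  refine measurable_pi_lambda _ fun n => ?_
  cases n with
  | zero => exact measurable_fst
  | succ n => exact (measurable_pi_apply n).comp measurable_snd

lemma map_consSeq {α : Type*} [MeasurableSpace α] (μ : Measure α) [IsProbabilityMeasure μ] :
    (μ.prod (Measure.infinitePi fun _ : ℕ => μ)).map consSeq =
      Measure.infinitePi fun _ : ℕ => μ := by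
  classical
  refine Measure.eq_infinitePi _ fun s t ht => ?_
  obtain ⟨N, hN⟩ : ∃ N : ℕ, s ⊆ Finset.range (N + 1) :=
    ⟨s.sup id, fun i hi => Finset.mem_range_succ_iff.2 (Finset.le_sup (f := id) hi)⟩
  set u : ℕ → Set α := fun i => if i ∈ s then t i else univ with hu
  have hum : ∀ i, MeasurableSet (u i) := fun i => by
    by_cases hi : i ∈ s <;> simp [hu, hi, ht i]
  have hpre : consSeq ⁻¹' (Set.pi (s : Set ℕ) t) =
      u 0 ×ˢ Set.pi (Finset.range N : Set ℕ) (fun i => u (i + 1)) := by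
    ext ⟨a, x⟩
    simp only [mem_preimage, Set.mem_pi, Finset.mem_coe, mem_prod, Finset.mem_range]
    constructor
    · intro h
      refine ⟨?_, fun i _ => ?_⟩
      · by_cases h0 : 0 ∈ s
        · simpa [hu, h0, consSeq] using h 0 h0
        · simp [hu, h0]
      · by_cases h0 : i + 1 ∈ s
        · simpa [hu, h0, consSeq] using h (i + 1) h0
        · simp [hu, h0]
    · rintro ⟨h0, h1⟩ i hi
      cases i with
      | zero => simpa [hu, hi, consSeq] using h0
      | succ i =>
        have := h1 i (by simpa using hN hi)
        simpa [hu, hi, consSeq] using this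
  rw [Measure.map_apply measurable_consSeq
    (MeasurableSet.pi s.countable_toSet fun i _ => ht i), hpre, Measure.prod_prod,
    Measure.infinitePi_pi _ fun i _ => hum _]
  have h1 : ∏ i ∈ s, μ (t i) = ∏ i ∈ Finset.range (N + 1), μ (u i) := by
    rw [← Finset.prod_subset hN]
    · exact Finset.prod_congr rfl fun i hi => by simp [hu, hi]
    · intro i _ hi
      simp [hu, hi]
  rw [h1, Finset.prod_range_succ', mul_comm]

/-- A random sequence with independent identically distributed entries splits into its first entry
and an independent sequence of the same law. -/
lemma lintegral_infinitePi_head_tail {α : Type*} [MeasurableSpace α] (μ : Measure α)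
    [IsProbabilityMeasure μ] {f : α → (ℕ → α) → ℝ≥0∞} (hf : Measurable (Function.uncurry f)) :
    ∫⁻ x, f (x 0) (fun n => x (n + 1)) ∂(Measure.infinitePi fun _ : ℕ => μ) =
      ∫⁻ a, ∫⁻ x, f a x ∂(Measure.infinitePi fun _ : ℕ => μ) ∂μ := by
  have hs : Measurable fun x : ℕ → α => (x 0, fun n => x (n + 1)) :=
    (measurable_pi_apply 0).prodMk (measurable_pi_lambda _ fun n => measurable_pi_apply (n + 1))
  have hm : Measurable fun x : ℕ → α => f (x 0) (fun n => x (n + 1)) := hf.comp hs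
  conv_lhs => rw [← map_consSeq μ]
  rw [lintegral_map hm measurable_consSeq]
  exact lintegral_prod _ hf.aemeasurable

/-- Weight `exp (-s T)` of a preemption: the next arrival, after a time `T`, finds the message in
service, whose requirement is `r`, unfinished and with at most `θ` units of service received. -/
noncomputable def restartWeight (θ s r T : ℝ) : ℝ≥0∞ :=
  if T ≤ θ ∧ T < r then ENNReal.ofReal (Real.exp (-s * T)) else 0

/-- Weight `exp (-s r)` of a service, of requirement `r`, that is not preempted and leaves a message
behind; `T` is the time to the next arrival. An arrival at the very instant of completion, `T = r`,
counts, since it is in the system immediately after the departure. -/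
noncomputable def successWeight (θ s r T : ℝ) : ℝ≥0∞ :=
  if ¬ (T ≤ θ ∧ T < r) ∧ T ≤ r then ENNReal.ofReal (Real.exp (-s * r)) else 0

/-- Weight of a cycle in which exactly `i` preemptions precede a completed service that leaves a
message behind. Here `r` is the requirement of the first message, and `x` lists the subsequent
interarrival times, each with the requirement of the message that ends it. The time spent on
preempted messages is weighted with rate `s₁`, the completed service with rate `s₂`. -/
noncomputable def cycleTerm (θ s₁ s₂ : ℝ) : ℕ → ℝ → (ℕ → ℝ × ℝ) → ℝ≥0∞
  | 0, r, x => successWeight θ s₂ r (x 0).1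
  | i + 1, r, x => restartWeight θ s₁ r (x 0).1 * cycleTerm θ s₁ s₂ i (x 0).2 fun n => x (n + 1)

/-- Weight of a cycle, whatever the number of preemptions; it vanishes if the first completed
service leaves the system empty. -/
noncomputable def cycleWeight (θ s₁ s₂ : ℝ) (r : ℝ) (x : ℕ → ℝ × ℝ) : ℝ≥0∞ :=
  ∑' i, cycleTerm θ s₁ s₂ i r x

lemma cycleWeight_eq (θ s₁ s₂ r : ℝ) (x : ℕ → ℝ × ℝ) :
    cycleWeight θ s₁ s₂ r x = successWeight θ s₂ r (x 0).1 +
      restartWeight θ s₁ r (x 0).1 * cycleWeight θ s₁ s₂ (x 0).2 fun n => x (n + 1) := by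
  rw [cycleWeight, tsum_eq_zero_add' ENNReal.summable, cycleWeight, ← ENNReal.tsum_mul_left]
  rfl

lemma measurable_restartWeight (θ s : ℝ) :
    Measurable fun p : ℝ × ℝ => restartWeight θ s p.1 p.2 := by
  refine Measurable.ite ?_ (by fun_prop) measurable_const
  exact (measurableSet_le measurable_snd measurable_const).inter
    (measurableSet_lt measurable_snd measurable_fst)

lemma measurable_successWeight (θ s : ℝ) :
    Measurable fun p : ℝ × ℝ => successWeight θ s p.1 p.2 := by
  refine Measurable.ite ?_ (by fun_prop) measurable_const
  exact ((measurableSet_le measurable_snd measurable_const).inter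
    (measurableSet_lt measurable_snd measurable_fst)).compl.inter
    (measurableSet_le measurable_snd measurable_fst)

lemma measurable_cycleTerm (θ s₁ s₂ : ℝ) (i : ℕ) :
    Measurable fun p : ℝ × (ℕ → ℝ × ℝ) => cycleTerm θ s₁ s₂ i p.1 p.2 := by
  have hx : Measurable fun p : ℝ × (ℕ → ℝ × ℝ) => p.2 0 :=
    (measurable_pi_apply 0).comp measurable_snd
  induction i with
  | zero => exact (measurable_successWeight θ s₂).comp (measurable_fst.prodMk hx.fst)
  | succ i ih =>
    refine ((measurable_restartWeight θ s₁).comp (measurable_fst.prodMk hx.fst)).mul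
      (ih.comp (hx.snd.prodMk ?_))
    exact measurable_pi_lambda _ fun n => (measurable_pi_apply (n + 1)).comp measurable_snd

lemma measurable_cycleWeight (θ s₁ s₂ : ℝ) :
    Measurable fun p : ℝ × (ℕ → ℝ × ℝ) => cycleWeight θ s₁ s₂ p.1 p.2 :=
  Measurable.tsum fun i => measurable_cycleTerm θ s₁ s₂ i

/-- Mean weight of a preemption, for an interarrival law `E` and a service law `G`. -/
noncomputable def restartFactor (E G : Measure ℝ) (θ s : ℝ) : ℝ≥0∞ :=
  ∫⁻ r, ∫⁻ T, restartWeight θ s r T ∂E ∂G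

/-- Mean weight of a completed service that leaves a message behind, for an interarrival law `E` and
a service law `G`. -/
noncomputable def successFactor (E G : Measure ℝ) (θ s : ℝ) : ℝ≥0∞ :=
  ∫⁻ r, ∫⁻ T, successWeight θ s r T ∂E ∂G

lemma lintegral_cycleTerm (E G : Measure ℝ) [IsProbabilityMeasure E] [IsProbabilityMeasure G]
    (θ s₁ s₂ : ℝ) (i : ℕ) :
    ∫⁻ r, ∫⁻ x, cycleTerm θ s₁ s₂ i r x ∂(Measure.infinitePi fun _ : ℕ => E.prod G) ∂G =
      restartFactor E G θ s₁ ^ i * successFactor E G θ s₂ := by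
  induction i with
  | zero =>
    rw [pow_zero, one_mul, successFactor]
    refine lintegral_congr fun r => ?_
    have hm : Measurable fun T : ℝ => successWeight θ s₂ r T :=
      (measurable_successWeight θ s₂).comp measurable_prodMk_left
    have := lintegral_infinitePi_head_tail (E.prod G)
      (f := fun a _ => successWeight θ s₂ r a.1) (hm.comp (measurable_fst.fst))
    simp only [cycleTerm]
    rw [this]
    simp only [lintegral_const, measure_univ, mul_one]
    rw [lintegral_prod (fun a : ℝ × ℝ => successWeight θ s₂ r a.1)
      (hm.comp measurable_fst).aemeasurable]
    simp
  | succ i ih =>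
    have hterm : Measurable fun p : ℝ × (ℕ → ℝ × ℝ) => cycleTerm θ s₁ s₂ i p.1 p.2 :=
      measurable_cycleTerm θ s₁ s₂ i
    have hin : Measurable fun b : ℝ =>
        ∫⁻ x, cycleTerm θ s₁ s₂ i b x ∂(Measure.infinitePi fun _ : ℕ => E.prod G) :=
      hterm.lintegral_prod_right'
    have key : ∀ r : ℝ,
        ∫⁻ x, cycleTerm θ s₁ s₂ (i + 1) r x ∂(Measure.infinitePi fun _ : ℕ => E.prod G) =
        (∫⁻ T, restartWeight θ s₁ r T ∂E) *
          (restartFactor E G θ s₁ ^ i * successFactor E G θ s₂) := by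
      intro r
      have hm : Measurable fun T : ℝ => restartWeight θ s₁ r T :=
        (measurable_restartWeight θ s₁).comp measurable_prodMk_left
      have := lintegral_infinitePi_head_tail (E.prod G)
        (f := fun a x => restartWeight θ s₁ r a.1 * cycleTerm θ s₁ s₂ i a.2 x)
        ((hm.comp (measurable_fst.fst)).mul
          (hterm.comp (measurable_fst.snd.prodMk measurable_snd)))
      simp only [cycleTerm]
      rw [this, ← ih]
      have h2 : ∀ a : ℝ × ℝ, ∫⁻ x, restartWeight θ s₁ r a.1 * cycleTerm θ s₁ s₂ i a.2 x
          ∂(Measure.infinitePi fun _ : ℕ => E.prod G) = restartWeight θ s₁ r a.1 *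
          ∫⁻ x, cycleTerm θ s₁ s₂ i a.2 x ∂(Measure.infinitePi fun _ : ℕ => E.prod G) :=
        fun a => lintegral_const_mul _ (hterm.comp measurable_prodMk_left)
      simp only [h2]
      exact lintegral_prod_mul hm.aemeasurable hin.aemeasurable
    simp only [key]
    rw [lintegral_mul_const, pow_succ', mul_assoc]
    · rfl
    · exact (measurable_restartWeight θ s₁).lintegral_prod_right'

/-- The attempts at a service are independent, so that the mean weight of a cycle is a geometric
series. -/
lemma lintegral_mul_cycleWeight (E G : Measure ℝ) [IsProbabilityMeasure E]
    [IsProbabilityMeasure G] (θ s₁ s₂ : ℝ) {f : ℝ → ℝ≥0∞} (hf : Measurable f) :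
    ∫⁻ x, f (x 0).1 * cycleWeight θ s₁ s₂ (x 0).2 (fun n => x (n + 1))
        ∂(Measure.infinitePi fun _ : ℕ => E.prod G) =
      (∫⁻ T, f T ∂E) *
        ((1 - restartFactor E G θ s₁)⁻¹ * successFactor E G θ s₂) := by
  have hw := measurable_cycleWeight θ s₁ s₂
  rw [lintegral_infinitePi_head_tail (E.prod G)
    (f := fun a x => f a.1 * cycleWeight θ s₁ s₂ a.2 x)
    ((hf.comp measurable_fst.fst).mul (hw.comp (measurable_fst.snd.prodMk measurable_snd)))]
  have h2 : ∀ a : ℝ × ℝ, ∫⁻ x, f a.1 * cycleWeight θ s₁ s₂ a.2 x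
      ∂(Measure.infinitePi fun _ : ℕ => E.prod G) = f a.1 *
      ∫⁻ x, cycleWeight θ s₁ s₂ a.2 x ∂(Measure.infinitePi fun _ : ℕ => E.prod G) :=
    fun a => lintegral_const_mul _ (hw.comp measurable_prodMk_left)
  simp only [h2]
  rw [lintegral_prod_mul hf.aemeasurable hw.lintegral_prod_right'.aemeasurable]
  congr 1
  have h3 : ∀ r, ∫⁻ x, cycleWeight θ s₁ s₂ r x ∂(Measure.infinitePi fun _ : ℕ => E.prod G) =
      ∑' i, ∫⁻ x, cycleTerm θ s₁ s₂ i r x ∂(Measure.infinitePi fun _ : ℕ => E.prod G) :=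
    fun r => lintegral_tsum fun i =>
      ((measurable_cycleTerm θ s₁ s₂ i).comp measurable_prodMk_left).aemeasurable
  simp only [h3]
  rw [lintegral_tsum fun i => (measurable_cycleTerm θ s₁ s₂ i).lintegral_prod_right'.aemeasurable]
  simp only [lintegral_cycleTerm]
  rw [ENNReal.tsum_mul_right, ENNReal.tsum_geometric]

/-! ### The exponential law, and the Laplace transforms of `J` and `F₁` -/

lemma lintegral_expMeasure {lam : ℝ} {f : ℝ → ℝ≥0∞} (hf : Measurable f) :
    ∫⁻ T, f T ∂(expMeasure lam) =
      ∫⁻ T in Ici 0, ENNReal.ofReal (lam * Real.exp (-lam * T)) * f T := by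
  have h0 : expMeasure lam = volume.withDensity (exponentialPDF lam) := rfl
  have hm : Measurable (exponentialPDF lam) :=
    (measurable_exponentialPDFReal lam).ennreal_ofReal
  rw [h0, lintegral_withDensity_eq_lintegral_mul _ hm hf,
    ← lintegral_indicator measurableSet_Ici]
  refine lintegral_congr fun T => ?_
  by_cases hT : 0 ≤ T
  · simp [exponentialPDF_of_nonneg hT, hT]
  · simp [exponentialPDF_of_neg (not_le.1 hT), hT]

lemma expMeasure_Iic {lam : ℝ} (hlam : 0 < lam) {x : ℝ} (hx : 0 ≤ x) :
    expMeasure lam (Iic x) = ENNReal.ofReal (1 - Real.exp (-lam * x)) := by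
  have h0 : expMeasure lam = volume.withDensity (exponentialPDF lam) := rfl
  rw [h0, withDensity_apply _ measurableSet_Iic, lintegral_exponentialPDF_eq_antiDeriv hlam,
    if_pos hx, neg_mul]

lemma expMeasure_singleton (lam x : ℝ) : expMeasure lam {x} = 0 :=
  withDensity_absolutelyContinuous _ _ (measure_singleton x)

lemma expMeasure_Iio {lam : ℝ} (hlam : 0 < lam) {x : ℝ} (hx : 0 ≤ x) :
    expMeasure lam (Iio x) = ENNReal.ofReal (1 - Real.exp (-lam * x)) := by
  rw [← expMeasure_Iic hlam hx, ← Iio_union_right]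
  refine le_antisymm (measure_mono subset_union_left) ((measure_union_le _ _).trans ?_)
  rw [expMeasure_singleton, add_zero]

lemma expMeasure_Ioc {lam : ℝ} (hlam : 0 < lam) {x y : ℝ} (hx : 0 ≤ x) (hxy : x ≤ y) :
    expMeasure lam (Ioc x y) =
      ENNReal.ofReal (Real.exp (-lam * x) - Real.exp (-lam * y)) := by
  have := isProbabilityMeasure_expMeasure hlam
  rw [← Iic_sdiff_Iic, measure_sdiff (Iic_subset_Iic.2 hxy) measurableSet_Iic.nullMeasurableSet
    (measure_ne_top _ _), expMeasure_Iic hlam hx, expMeasure_Iic hlam (hx.trans hxy),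
    ← ENNReal.ofReal_sub]
  · congr 1; ring
  · rw [sub_nonneg, Real.exp_le_one_iff]; nlinarith

lemma expMeasure_Ioi_ne_zero {lam : ℝ} (hlam : 0 < lam) {x : ℝ} (hx : 0 ≤ x) :
    expMeasure lam (Ioi x) ≠ 0 := by
  have h : ENNReal.ofReal (Real.exp (-lam * x) - Real.exp (-lam * (x + 1))) ≠ 0 := by
    rw [Ne, ENNReal.ofReal_eq_zero, not_le, sub_pos, Real.exp_lt_exp]
    nlinarith
  rw [← expMeasure_Ioc hlam hx (by linarith)] at h
  exact fun h0 => h (measure_mono_null Ioc_subset_Ioi_self h0)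

/-- Laplace transform of the exponential law. -/
lemma lintegral_exp_expMeasure {lam s : ℝ} (hlam : 0 < lam) (hs : 0 ≤ s) :
    ∫⁻ T, ENNReal.ofReal (Real.exp (-s * T)) ∂(expMeasure lam) =
      ENNReal.ofReal (lam / (lam + s)) := by
  have hls : -(lam + s) < 0 := by linarith
  have hI : IntegrableOn (fun T => lam * Real.exp (-(lam + s) * T)) (Ioi 0) :=
    (integrableOn_exp_mul_Ioi hls 0).const_mul lam
  rw [lintegral_expMeasure (by fun_prop), setLIntegral_congr Ioi_ae_eq_Ici.symm]
  have h1 : ∀ T : ℝ, ENNReal.ofReal (lam * Real.exp (-lam * T)) *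
      ENNReal.ofReal (Real.exp (-s * T)) =
      ENNReal.ofReal (lam * Real.exp (-(lam + s) * T)) := fun T => by
    rw [← ENNReal.ofReal_mul (by positivity), mul_assoc, ← Real.exp_add]
    ring_nf
  simp only [h1]
  rw [← ofReal_integral_eq_lintegral_ofReal hI (ae_of_all _ fun T => by positivity),
    integral_const_mul, integral_exp_mul_Ioi hls]
  congr 1
  have : lam + s ≠ 0 := by linarith
  simp only [mul_zero, Real.exp_zero]
  field_simp

section Factors

variable {lam : ℝ} {G : Measure ℝ} {θ : ℝ}

/-- The next arrival falls into `(θ, r]` with probability `exp (-lam θ) - exp (-lam r)`. -/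
lemma successFactor_eq (hlam : 0 < lam) (hθ : 0 ≤ θ) (s : ℝ) :
    successFactor (expMeasure lam) G θ s = ∫⁻ r in Ioi θ,
      ENNReal.ofReal ((Real.exp (-lam * θ) - Real.exp (-lam * r)) * Real.exp (-s * r)) ∂G := by
  rw [successFactor, ← lintegral_indicator measurableSet_Ioi]
  refine lintegral_congr fun r => ?_
  have hS : MeasurableSet {T : ℝ | ¬ (T ≤ θ ∧ T < r) ∧ T ≤ r} :=
    ((measurableSet_le measurable_id measurable_const).inter
      (measurableSet_lt measurable_id measurable_const)).compl.inter
        (measurableSet_le measurable_id measurable_const)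
  have h1 : ∫⁻ T, successWeight θ s r T ∂(expMeasure lam) =
      ENNReal.ofReal (Real.exp (-s * r)) *
        expMeasure lam {T : ℝ | ¬ (T ≤ θ ∧ T < r) ∧ T ≤ r} := by
    rw [← setLIntegral_const, ← lintegral_indicator hS]
    refine lintegral_congr fun T => ?_
    simp only [successWeight, indicator, mem_ofPred_eq]
  rw [h1]
  by_cases hr : θ < r
  · have h2 : {T : ℝ | ¬ (T ≤ θ ∧ T < r) ∧ T ≤ r} = Ioc θ r := by
      ext T
      simp only [mem_ofPred_eq, mem_Ioc, not_and, not_lt]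
      constructor
      · rintro ⟨h, h'⟩
        refine ⟨?_, h'⟩
        by_contra hc
        have := h (not_lt.1 hc)
        linarith
      · rintro ⟨h, h'⟩
        exact ⟨fun hc => absurd h (not_lt.2 hc), h'⟩
    rw [h2, expMeasure_Ioc hlam hθ hr.le, indicator_of_mem (by exact hr), mul_comm,
      ← ENNReal.ofReal_mul]
    rw [sub_nonneg, Real.exp_le_exp]
    nlinarith
  · have h2 : {T : ℝ | ¬ (T ≤ θ ∧ T < r) ∧ T ≤ r} ⊆ {r} := by
      rintro T ⟨h, h'⟩
      by_contra hc
      have hlt : T < r := lt_of_le_of_ne h' hc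
      exact h ⟨by linarith, hlt⟩
    rw [measure_mono_null h2 (expMeasure_singleton _ _), indicator_of_notMem (by simpa using hr),
      mul_zero]

lemma restartFactor_eq [IsProbabilityMeasure G] (hlam : 0 < lam) (s : ℝ) :
    restartFactor (expMeasure lam) G θ s = ∫⁻ T in Ico 0 θ,
      ENNReal.ofReal (lam * Real.exp (-lam * T) * (1 - G.real (Iic T)) * Real.exp (-s * T)) := by
  have := isProbabilityMeasure_expMeasure hlam
  have hm := measurable_restartWeight θ s
  rw [restartFactor, lintegral_lintegral_swap hm.aemeasurable]
  have h1 : ∀ T, ∫⁻ r, restartWeight θ s r T ∂G =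
      if T ≤ θ then ENNReal.ofReal (Real.exp (-s * T) * (1 - G.real (Iic T))) else 0 := by
    intro T
    by_cases hT : T ≤ θ
    · have h2 : (fun r => restartWeight θ s r T) =
          (Ioi T).indicator fun _ => ENNReal.ofReal (Real.exp (-s * T)) := by
        ext r
        simp [restartWeight, hT, indicator]
      rw [h2, lintegral_indicator measurableSet_Ioi, setLIntegral_const, if_pos hT,
        ENNReal.ofReal_mul (by positivity), ← probReal_compl_eq_one_sub measurableSet_Iic,
        compl_Iic, ofReal_measureReal]
    · simp [restartWeight, hT]
  rw [lintegral_expMeasure hm.lintegral_prod_left']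
  simp only [h1]
  rw [← setLIntegral_congr (Ico_ae_eq_Icc (a := (0 : ℝ)) (b := θ)).symm,
    ← lintegral_indicator measurableSet_Ici, ← lintegral_indicator measurableSet_Icc]
  refine lintegral_congr fun T => ?_
  by_cases h0 : 0 ≤ T
  · by_cases hT : T ≤ θ
    · simp only [indicator, mem_Ici, mem_Icc, h0, hT, and_self, if_true]
      rw [← ENNReal.ofReal_mul (by positivity)]
      congr 1; ring
    · simp [indicator, h0, hT]
  · simp [indicator, h0]

lemma restartFactor_zero_eq [IsProbabilityMeasure G] (hlam : 0 < lam) (hθ : 0 ≤ θ)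
    (hGpos : G (Iic 0) = 0) :
    restartFactor (expMeasure lam) G θ 0 =
      ∫⁻ r, ENNReal.ofReal (1 - Real.exp (-lam * min θ r)) ∂G := by
  have hae : ∀ᵐ r ∂G, 0 < r := by
    rw [ae_iff]; simpa [Iic] using hGpos
  refine lintegral_congr_ae ?_
  filter_upwards [hae] with r hr
  have hS : MeasurableSet {T : ℝ | T ≤ θ ∧ T < r} :=
    ((measurableSet_le measurable_id measurable_const).inter
      (measurableSet_lt measurable_id measurable_const))
  have h1 : ∫⁻ T, restartWeight θ 0 r T ∂(expMeasure lam) =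
      expMeasure lam {T : ℝ | T ≤ θ ∧ T < r} := by
    rw [← lintegral_indicator_one hS]
    refine lintegral_congr fun T => ?_
    simp [restartWeight, indicator]
  have hmin : 0 ≤ min θ r := le_min hθ hr.le
  rw [h1]
  refine le_antisymm ?_ ?_
  · rw [← expMeasure_Iic hlam hmin]
    exact measure_mono fun T hT => le_min hT.1 hT.2.le
  · rw [← expMeasure_Iio hlam hmin]
    exact measure_mono fun T hT => ⟨(lt_min_iff.1 hT).1.le, (lt_min_iff.1 hT).2⟩

lemma restartFactor_mono [IsProbabilityMeasure G] (hlam : 0 < lam) {s : ℝ} (hs : 0 ≤ s) :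
    restartFactor (expMeasure lam) G θ s ≤ restartFactor (expMeasure lam) G θ 0 := by
  rw [restartFactor_eq hlam, restartFactor_eq hlam]
  refine setLIntegral_mono' measurableSet_Ico fun T hT => ENNReal.ofReal_le_ofReal ?_
  have h0 : 0 ≤ 1 - G.real (Iic T) := sub_nonneg.2 measureReal_le_one
  have h1 : Real.exp (-s * T) ≤ Real.exp (-0 * T) := by
    rw [Real.exp_le_exp]; nlinarith [hT.1]
  gcongr

lemma integrable_exp_min [IsProbabilityMeasure G] (hlam : 0 < lam) (hθ : 0 ≤ θ)
    (hGpos : G (Iic 0) = 0) : Integrable (fun x => Real.exp (-lam * min θ x)) G := by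
  have hae : ∀ᵐ r ∂G, 0 < r := by
    rw [ae_iff]; simpa [Iic] using hGpos
  refine Integrable.of_bound (by fun_prop) 1 ?_
  filter_upwards [hae] with r hr
  rw [Real.norm_eq_abs, Real.abs_exp, Real.exp_le_one_iff]
  have := le_min hθ hr.le
  nlinarith

/-- The quantity `q`, defined as an integral, is the probability that the service of a message is
preempted. -/
lemma restartFactor_zero [IsProbabilityMeasure G] (hlam : 0 < lam) (hθ : 0 ≤ θ)
    (hGpos : G (Iic 0) = 0) :
    restartFactor (expMeasure lam) G θ 0 = ENNReal.ofReal (preemptProb lam G θ) := by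
  have hae : ∀ᵐ r ∂G, 0 < r := by
    rw [ae_iff]; simpa [Iic] using hGpos
  have hI := integrable_exp_min hlam hθ hGpos
  have hI' : Integrable (fun x => 1 - Real.exp (-lam * min θ x)) G := (integrable_const 1).sub hI
  rw [restartFactor_zero_eq hlam hθ hGpos, ← ofReal_integral_eq_lintegral_ofReal hI',
    integral_sub (integrable_const 1) hI, preemptProb]
  · simp
  · filter_upwards [hae] with r hr
    have := le_min hθ hr.le
    simp only [Pi.zero_apply, sub_nonneg, Real.exp_le_one_iff]
    nlinarith

lemma preemptProb_lt_one [IsProbabilityMeasure G] (hlam : 0 < lam) (hθ : 0 ≤ θ)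
    (hGpos : G (Iic 0) = 0) : preemptProb lam G θ < 1 := by
  have := integral_exp_pos (integrable_exp_min hlam hθ hGpos)
  rw [preemptProb]
  linarith

lemma preemptProb_nonneg [IsProbabilityMeasure G] (hlam : 0 < lam) (hθ : 0 ≤ θ)
    (hGpos : G (Iic 0) = 0) : 0 ≤ preemptProb lam G θ := by
  have hae : ∀ᵐ r ∂G, 0 < r := by
    rw [ae_iff]; simpa [Iic] using hGpos
  have h : ∫ x, Real.exp (-lam * min θ x) ∂G ≤ ∫ _, 1 ∂G := by
    refine integral_mono_ae (integrable_exp_min hlam hθ hGpos) (integrable_const 1) ?_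
    filter_upwards [hae] with r hr
    have := le_min hθ hr.le
    rw [Real.exp_le_one_iff]
    nlinarith
  rw [preemptProb]
  rw [integral_const, probReal_univ, one_smul] at h
  linarith

lemma restartFactor_lt_one [IsProbabilityMeasure G] (hlam : 0 < lam) (hθ : 0 ≤ θ)
    (hGpos : G (Iic 0) = 0) {s : ℝ} (hs : 0 ≤ s) :
    restartFactor (expMeasure lam) G θ s < 1 := by
  refine (restartFactor_mono hlam hs).trans_lt ?_
  rw [restartFactor_zero hlam hθ hGpos, ENNReal.ofReal_lt_one]
  exact preemptProb_lt_one hlam hθ hGpos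

lemma measurable_preempt_density [IsProbabilityMeasure G] :
    Measurable fun T => 1 - G.real (Iic T) := by
  have : Monotone fun T => G.real (Iic T) := fun a b hab =>
    measureReal_mono (Iic_subset_Iic.2 hab)
  exact measurable_const.sub this.measurable

/-- The density of `J` is, up to the factor `q`, that of the time of a preemption. If `q = 0` both
sides vanish. -/
lemma restartFactor_toReal [IsProbabilityMeasure G] (hlam : 0 < lam) (hθ : 0 ≤ θ)
    (hGpos : G (Iic 0) = 0) {s : ℝ} (hs : 0 ≤ s) :
    (restartFactor (expMeasure lam) G θ s).toReal =
      preemptProb lam G θ * laplace (lawJ lam G θ) s := by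
  by_cases hq : preemptProb lam G θ = 0
  · have h := restartFactor_mono (G := G) (θ := θ) hlam hs
    rw [restartFactor_zero hlam hθ hGpos, hq, ENNReal.ofReal_zero, nonpos_iff_eq_zero] at h
    simp [hq, h]
  have hθ0 : θ ≠ 0 := by
    rintro rfl
    have h := restartFactor_eq (G := G) (θ := 0) hlam 0
    rw [restartFactor_zero hlam hθ hGpos] at h
    simp at h
    exact hq (le_antisymm h (preemptProb_nonneg hlam hθ hGpos))
  have hqn := preemptProb_nonneg hlam hθ hGpos
  have hd := measurable_preempt_density (G := G)
  have hdn : ∀ T, 0 ≤ 1 - G.real (Iic T) := fun T => sub_nonneg.2 measureReal_le_one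
  rw [laplace, lawJ, if_neg hθ0, integral_withDensity_eq_integral_toReal_smul (by fun_prop)
    (by simp), restartFactor_eq hlam, ← integral_toReal (by fun_prop) (by simp),
    ← integral_const_mul]
  refine integral_congr_ae (ae_of_all _ fun T => ?_)
  have := hdn T
  simp only [smul_eq_mul]
  rw [ENNReal.toReal_ofReal (by positivity), ENNReal.toReal_ofReal (by positivity)]
  field_simp

lemma successFactor_toReal (hlam : 0 < lam) (hθ : 0 ≤ θ) (s : ℝ) :
    (successFactor (expMeasure lam) G θ s).toReal = ∫ r in Ioi θ,
      (Real.exp (-lam * θ) - Real.exp (-lam * r)) * Real.exp (-s * r) ∂G := by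
  rw [successFactor_eq hlam hθ, ← integral_toReal (by fun_prop) (by simp)]
  refine setIntegral_congr_fun measurableSet_Ioi fun r hr => ?_
  have : Real.exp (-lam * r) ≤ Real.exp (-lam * θ) := by
    rw [Real.exp_le_exp]; nlinarith [mem_Ioi.1 hr]
  exact ENNReal.toReal_ofReal (mul_nonneg (sub_nonneg.2 this) (by positivity))

lemma successFactor_ne_top [IsProbabilityMeasure G] (hlam : 0 < lam) (hθ : 0 ≤ θ) {s : ℝ}
    (hs : 0 ≤ s) : successFactor (expMeasure lam) G θ s ≠ ∞ := by
  refine ne_top_of_le_ne_top (b := ∫⁻ _ in Ioi θ, 1 ∂G) (by simp) ?_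
  rw [successFactor_eq hlam hθ]
  refine setLIntegral_mono' measurableSet_Ioi fun r hr => ?_
  rw [ENNReal.ofReal_le_one]
  have hr' := mem_Ioi.1 hr
  have h1 : Real.exp (-lam * θ) ≤ 1 := by rw [Real.exp_le_one_iff]; nlinarith
  have h2 : Real.exp (-s * r) ≤ 1 := by rw [Real.exp_le_one_iff]; nlinarith
  have h3 := Real.exp_pos (-lam * r)
  have h4 := Real.exp_pos (-s * r)
  nlinarith

lemma successFactor_ne_zero (hlam : 0 < lam) (hθ : 0 ≤ θ) (hGθ : G (Ioi θ) ≠ 0) (s : ℝ) :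
    successFactor (expMeasure lam) G θ s ≠ 0 := by
  rw [successFactor_eq hlam hθ]
  intro h
  rw [setLIntegral_eq_zero_iff measurableSet_Ioi (by fun_prop)] at h
  refine hGθ (measure_mono_null ?_ (ae_iff.1 h))
  intro r hr h0
  have h1 := h0 hr
  rw [ENNReal.ofReal_eq_zero, ← not_lt] at h1
  refine h1 (mul_pos ?_ (Real.exp_pos _))
  rw [sub_pos, Real.exp_lt_exp]
  nlinarith [mem_Ioi.1 hr]

lemma laplace_lawF1 (hlam : 0 < lam) (hθ : 0 ≤ θ) (s : ℝ) :
    laplace (lawF1 lam G θ) s = (successFactor (expMeasure lam) G θ s).toReal /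
      (successFactor (expMeasure lam) G θ 0).toReal := by
  have hpos : ∀ r ∈ Ioi θ, 0 ≤ Real.exp (-lam * θ) - Real.exp (-lam * r) := fun r hr => by
    rw [sub_nonneg, Real.exp_le_exp]; nlinarith [mem_Ioi.1 hr]
  have h0 : (successFactor (expMeasure lam) G θ 0).toReal =
      ∫ z in Ioi θ, (Real.exp (-lam * θ) - Real.exp (-lam * z)) ∂G := by
    rw [successFactor_toReal hlam hθ]; simp
  have hD : 0 ≤ ∫ z in Ioi θ, (Real.exp (-lam * θ) - Real.exp (-lam * z)) ∂G := by
    rw [← h0]; exact ENNReal.toReal_nonneg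
  rw [h0, successFactor_toReal hlam hθ, laplace, lawF1,
    integral_withDensity_eq_integral_toReal_smul (by fun_prop) (by simp), ← integral_div]
  refine setIntegral_congr_fun measurableSet_Ioi fun r hr => ?_
  simp only [smul_eq_mul]
  rw [ENNReal.toReal_ofReal (div_nonneg (hpos r hr) hD)]
  ring

end Factors

/-! ### Paths of the system -/

namespace State

lemma advance_add {h h' : ℝ} (hh' : 0 ≤ h') (S : State) :
    S.advance (h + h') = (S.advance h).advance h' := by
  cases S with
  | empty => rfl
  | one a u r =>
    by_cases h1 : u + h < r
    · simp [advance, h1, add_assoc]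
    · have h2 : ¬ u + (h + h') < r := by linarith
      simp [advance, h1, h2]
  | two a u r a' r' =>
    by_cases h1 : u + h < r
    · simp [advance, h1, add_assoc]
    · have h2 : ¬ u + (h + h') < r := by linarith
      by_cases h3 : u + h - r < r'
      · have e : u + (h + h') - r = u + h - r + h' := by ring
        simp [advance, h1, h2, h3, add_assoc, e]
      · have h4 : ¬ u + (h + h') - r < r' := by linarith
        simp [advance, h1, h2, h3, h4]

lemma not_completes_of_advance_eq_empty {h h' b : ℝ} {S : State} (hS : S.advance h = empty)
    (hh : h < h') : ¬ S.Completes h' b := by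
  cases S with
  | empty => exact id
  | one a u r =>
    rintro ⟨h1, -⟩
    have h2 : u + h < r := by linarith
    simp [advance, h2] at hS
  | two a u r a' r' =>
    by_cases h2 : u + h < r
    · simp [advance, h2] at hS
    by_cases h3 : u + h - r < r'
    · simp [advance, h2, h3] at hS
    rintro (⟨h1, -⟩ | ⟨h1, -⟩) <;> linarith

end State

namespace StationarySystem

variable {Ω : Type*} [MeasurableSpace Ω] {P : Measure Ω} {lam : ℝ} {G : Measure ℝ} {θ : ℝ}

/-- A departure at time `t` of a message that arrived at time `a`. -/
abbrev DepartsAt (X : StationarySystem P lam G θ) (ω : Ω) (t a : ℝ) : Prop :=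
  Departs (fun n => X.arr n ω) (fun u => X.state u ω) t a

variable (X : StationarySystem P lam G θ) (ω : Ω)

lemma arr_lt_arr_succ (n : ℤ) : X.arr n ω < X.arr (n + 1) ω :=
  X.arr_strictMono ω (by simp : n < n + 1)

lemma exists_arr_le_lt (t : ℝ) : ∃ n, X.arr n ω ≤ t ∧ t < X.arr (n + 1) ω := by
  obtain ⟨b, hb⟩ := ((X.arr_atTop ω).eventually_gt_atTop t).exists
  obtain ⟨c, hc⟩ := ((X.arr_atBot ω).eventually_lt_atBot t).exists
  obtain ⟨n, hn, hmax⟩ := Int.exists_greatest_of_bdd (P := fun n => X.arr n ω ≤ t)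
    ⟨b, fun z hz => le_of_lt ((X.arr_strictMono ω).lt_iff_lt.1 (lt_of_le_of_lt hz hb))⟩ ⟨c, hc.le⟩
  refine ⟨n, hn, ?_⟩
  by_contra h
  have := hmax _ (not_lt.1 h)
  omega

lemma exists_arr_lt_le (t : ℝ) : ∃ n, X.arr n ω < t ∧ t ≤ X.arr (n + 1) ω := by
  obtain ⟨n, h1, h2⟩ := X.exists_arr_le_lt ω t
  rcases h1.lt_or_eq with h | h
  · exact ⟨n, h, h2.le⟩
  · refine ⟨n - 1, ?_, by simp [h]⟩
    rw [← h]
    exact X.arr_strictMono ω (by simp : n - 1 < n)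

lemma departsAt_iff {n : ℤ} {t a : ℝ} (h1 : X.arr n ω < t) (h2 : t ≤ X.arr (n + 1) ω) :
    X.DepartsAt ω t a ↔ (X.state (X.arr n ω) ω).Completes (t - X.arr n ω) (t - a) := by
  constructor
  · rintro ⟨m, h3, h4, h5⟩
    have hmn : m = n := by
      have e1 := (X.arr_strictMono ω).lt_iff_lt.1 (lt_of_lt_of_le h1 h4)
      have e2 := (X.arr_strictMono ω).lt_iff_lt.1 (lt_of_lt_of_le h3 h2)
      omega
    subst hmn
    exact h5
  · exact fun h => ⟨n, h1, h2, h⟩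

lemma exists_dep_eq_iff {t : ℝ} : (∃ j, X.dep j ω = t) ↔ ∃ a, X.DepartsAt ω t a := by
  have := X.range_dep ω
  rw [Set.ext_iff] at this
  exact this t

lemma dep_one_eq {t a : ℝ} (ht : 0 < t) (hd : X.DepartsAt ω t a)
    (hn : ∀ t' a', 0 < t' → t' < t → ¬ X.DepartsAt ω t' a') : X.dep 1 ω = t := by
  obtain ⟨j, hj⟩ := (X.exists_dep_eq_iff ω).2 ⟨a, hd⟩
  obtain ⟨a', ha'⟩ := (X.exists_dep_eq_iff ω).1 ⟨1, rfl⟩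
  have h1 : (0 : ℤ) < j := (X.dep_strictMono ω).lt_iff_lt.1
    (lt_of_le_of_lt (X.dep_zero_nonpos ω) (by simpa [hj] using ht))
  have h2 : X.dep 1 ω ≤ X.dep j ω := (X.dep_strictMono ω).monotone (by omega : (1 : ℤ) ≤ j)
  refine le_antisymm (h2.trans hj.le) (not_lt.1 fun h => ?_)
  exact hn _ a' (X.dep_one_pos ω) h ha'

/-- An arrival that finds the message in cell 1 unfinished and with at most `θ` units of service
replaces it, and no departure occurs in between. -/
lemma state_arr_succ_of_preempt {k : ℤ}
    (hk : X.state (X.arr k ω) ω = .one 0 0 (X.svc k ω))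
    (hθ : X.arr (k + 1) ω - X.arr k ω ≤ θ) (hr : X.arr (k + 1) ω - X.arr k ω < X.svc k ω) :
    X.state (X.arr (k + 1) ω) ω = .one 0 0 (X.svc (k + 1) ω) ∧
      ∀ t a, X.arr k ω < t → t ≤ X.arr (k + 1) ω → ¬ X.DepartsAt ω t a := by
  constructor
  · rw [X.state_arrival, hk]
    simp [State.advance, State.arrive, hr, hθ]
  · intro t a h1 h2
    rw [X.departsAt_iff ω h1 h2, hk]
    rintro ⟨h3, -⟩
    linarith

/-- Once the message in cell 1 has received more than `θ` units of service, it stays there until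
it is completed, and each new message replaces the waiting one. -/
lemma state_arr_of_secured {k : ℤ}
    (hk : X.state (X.arr k ω) ω = .one 0 0 (X.svc k ω))
    (hθ : θ < X.arr (k + 1) ω - X.arr k ω) (j : ℕ)
    (hj : X.arr (k + 1 + j) ω < X.arr k ω + X.svc k ω) :
    X.state (X.arr (k + 1 + j) ω) ω = .two (X.arr (k + 1 + j) ω - X.arr k ω)
      (X.arr (k + 1 + j) ω - X.arr k ω) (X.svc k ω) 0 (X.svc (k + 1 + j) ω) := by
  induction j with
  | zero =>
    simp only [Nat.cast_zero, add_zero] at hj ⊢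
    have h1 : X.arr (k + 1) ω - X.arr k ω < X.svc k ω := by linarith
    rw [X.state_arrival, hk]
    simp [State.advance, State.arrive, h1, not_le.2 hθ]
  | succ j ih =>
    have e : k + 1 + ((j + 1 : ℕ) : ℤ) = k + 1 + (j : ℤ) + 1 := by push_cast; ring
    rw [e] at hj ⊢
    have hlt := X.arr_lt_arr_succ ω (k + 1 + j)
    have hle : X.arr (k + 1) ω ≤ X.arr (k + 1 + j) ω :=
      (X.arr_strictMono ω).monotone (by simp : k + 1 ≤ k + 1 + (j : ℤ))
    have h1 : X.arr (k + 1 + j + 1) ω - X.arr k ω < X.svc k ω := by linarith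
    have h2 : θ < X.arr (k + 1 + j + 1) ω - X.arr k ω := by linarith
    rw [X.state_arrival, ih (hlt.trans hj)]
    simp [State.advance, State.arrive, h1, not_le.2 h2]

/-- A service that is not interrupted by an arrival within its first `θ` units of time is
completed, and a message is left behind exactly if some message arrived during the service. -/
lemma departure_of_not_preempt (hθ0 : 0 ≤ θ) {k : ℤ}
    (hk : X.state (X.arr k ω) ω = .one 0 0 (X.svc k ω))
    (hT : ¬ (X.arr (k + 1) ω - X.arr k ω ≤ θ ∧ X.arr (k + 1) ω - X.arr k ω < X.svc k ω)) :
    X.DepartsAt ω (X.arr k ω + X.svc k ω) (X.arr k ω) ∧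
    (∀ t a, X.arr k ω < t → t < X.arr k ω + X.svc k ω → ¬ X.DepartsAt ω t a) ∧
    (∀ a, X.DepartsAt ω (X.arr k ω + X.svc k ω) a → a = X.arr k ω) ∧
    (X.state (X.arr k ω + X.svc k ω) ω).count =
      if X.arr (k + 1) ω - X.arr k ω ≤ X.svc k ω then 1 else 0 := by
  have hr := X.svc_pos k ω
  have hlt := X.arr_lt_arr_succ ω k
  by_cases hTr : X.svc k ω ≤ X.arr (k + 1) ω - X.arr k ω
  · -- no arrival during the service
    have hD : ∀ t a, X.arr k ω < t → t ≤ X.arr k ω + X.svc k ω →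
        (X.DepartsAt ω t a ↔ t - X.arr k ω = X.svc k ω ∧ t - a = t - X.arr k ω) := by
      intro t a h1 h2
      rw [X.departsAt_iff ω h1 (by linarith), hk]
      simp [State.Completes]
    refine ⟨?_, fun t a h1 h2 h => ?_, fun a h => ?_, ?_⟩
    · rw [hD _ _ (by linarith) le_rfl]; simp
    · rw [hD _ _ h1 h2.le] at h
      linarith
    · rw [hD _ _ (by linarith) le_rfl] at h
      linarith
    · rcases hTr.lt_or_eq with h | h
      · rw [X.state_between k _ ω (by linarith) (by linarith), hk, if_neg (not_le.2 h)]
        simp [State.advance, State.count]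
      · have e : X.arr k ω + X.svc k ω = X.arr (k + 1) ω := by linarith
        rw [e, X.state_arrival, hk, if_pos h.ge]
        simp [State.advance, State.arrive, State.count, ← h]
  · rw [not_le] at hTr
    have hθT : θ < X.arr (k + 1) ω - X.arr k ω := by
      by_contra h
      exact hT ⟨not_lt.1 h, hTr⟩
    have hst := X.state_arr_of_secured ω hk hθT
    have hmid : ∀ t, X.arr k ω < t → t ≤ X.arr k ω + X.svc k ω → t ≤ X.arr (k + 1) ω ∨
        ∃ j : ℕ, X.arr (k + 1 + j) ω < t ∧ t ≤ X.arr (k + 1 + j + 1) ω := by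
      intro t h1 h2
      obtain ⟨m, h3, h4⟩ := X.exists_arr_lt_le ω t
      have hkm : k ≤ m := by
        have := (X.arr_strictMono ω).lt_iff_lt.1 (lt_of_lt_of_le h1 h4)
        omega
      obtain ⟨i, rfl⟩ := Int.le.dest hkm
      cases i with
      | zero => left; simpa using h4
      | succ j =>
        right
        refine ⟨j, ?_, ?_⟩
        · convert h3 using 2; push_cast; ring
        · convert h4 using 2; push_cast; ring
    have hD : ∀ t a, X.arr k ω < t → t ≤ X.arr k ω + X.svc k ω →
        (X.DepartsAt ω t a ↔ t - X.arr k ω = X.svc k ω ∧ t - a = t - X.arr k ω) := by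
      intro t a h1 h2
      rcases hmid t h1 h2 with h | ⟨j, h3, h4⟩
      · rw [X.departsAt_iff ω h1 h, hk]
        simp [State.Completes]
      · rw [X.departsAt_iff ω h3 h4, hst j (by linarith)]
        have := X.svc_pos (k + 1 + j) ω
        constructor
        · rintro (⟨h5, h6⟩ | ⟨h5, h6⟩)
          · constructor <;> linarith
          · linarith
        · rintro ⟨h5, h6⟩
          left
          constructor <;> linarith
    refine ⟨?_, fun t a h1 h2 h => ?_, fun a h => ?_, ?_⟩
    · rw [hD _ _ (by linarith) le_rfl]; simp
    · rw [hD _ _ h1 h2.le] at h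
      linarith
    · rw [hD _ _ (by linarith) le_rfl] at h
      linarith
    · rw [if_pos hTr.le]
      rcases hmid (X.arr k ω + X.svc k ω) (by linarith) le_rfl with h | ⟨j, h3, h4⟩
      · linarith
      · have h5 := hst j h3
        have h6 := X.svc_pos (k + 1 + j) ω
        have e : X.arr (k + 1 + j) ω - X.arr k ω +
            (X.arr k ω + X.svc k ω - X.arr (k + 1 + j) ω) = X.svc k ω := by ring
        rcases h4.lt_or_eq with h | h
        · rw [X.state_between (k + 1 + j) _ ω h3.le h, h5]
          simp [State.advance, e, h6, State.count]
        · rw [h, X.state_arrival, ← h, h5]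
          simp [State.advance, e, h6, State.count, State.arrive, hθ0]

/-- The interarrival times after the arrival with index `k`, each with the service requirement of
the message that ends it. -/
def marksAfter (k : ℤ) (j : ℕ) : ℝ × ℝ :=
  (X.arr (k + j + 1) ω - X.arr (k + j) ω, X.svc (k + j + 1) ω)

lemma marksAfter_zero_fst (k : ℤ) : (X.marksAfter ω k 0).1 = X.arr (k + 1) ω - X.arr k ω := by
  simp [marksAfter]

lemma marksAfter_zero_snd (k : ℤ) : (X.marksAfter ω k 0).2 = X.svc (k + 1) ω := by
  simp [marksAfter]

lemma marksAfter_tail (k : ℤ) : (fun j => X.marksAfter ω k (j + 1)) = X.marksAfter ω (k + 1) := by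
  funext j
  have e : k + ((j + 1 : ℕ) : ℤ) = k + 1 + (j : ℤ) := by push_cast; ring
  simp only [marksAfter, e]

lemma future_tail : (fun j => future X.arr X.svc ω (j + 1)) = X.marksAfter ω 1 := by
  funext j
  simp [future, marksAfter, add_comm, add_left_comm]

/-- During a run of preemptions nothing departs, and each preemption contributes its factor to the
weight of the cycle. -/
lemma run_of_preempt (s₁ s₂ : ℝ) {k : ℤ}
    (hk : X.state (X.arr k ω) ω = .one 0 0 (X.svc k ω)) (N : ℕ)
    (hN : ∀ j : ℕ, j < N → X.arr (k + j + 1) ω - X.arr (k + j) ω ≤ θ ∧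
      X.arr (k + j + 1) ω - X.arr (k + j) ω < X.svc (k + j) ω) :
    X.state (X.arr (k + N) ω) ω = .one 0 0 (X.svc (k + N) ω) ∧
    (∀ t a, X.arr k ω < t → t ≤ X.arr (k + N) ω → ¬ X.DepartsAt ω t a) ∧
    cycleWeight θ s₁ s₂ (X.svc k ω) (X.marksAfter ω k) =
      ENNReal.ofReal (Real.exp (-s₁ * (X.arr (k + N) ω - X.arr k ω))) *
        cycleWeight θ s₁ s₂ (X.svc (k + N) ω) (X.marksAfter ω (k + N)) := by
  induction N with
  | zero =>
    simp only [Nat.cast_zero, add_zero, sub_self, mul_zero, Real.exp_zero, ENNReal.ofReal_one,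
      one_mul, and_true]
    exact ⟨hk, fun t a h1 h2 => by linarith⟩
  | succ N ih =>
    obtain ⟨h1, h2, h3⟩ := ih fun j hj => hN j (by omega)
    obtain ⟨hT, hr⟩ := hN N (by omega)
    have e : k + ((N + 1 : ℕ) : ℤ) = k + N + 1 := by push_cast; ring
    obtain ⟨h4, h5⟩ := X.state_arr_succ_of_preempt ω h1 hT hr
    rw [e]
    refine ⟨h4, fun t a h6 h7 => ?_, ?_⟩
    · rcases le_or_gt t (X.arr (k + N) ω) with h | h
      · exact h2 t a h6 h
      · exact h5 t a h h7
    · rw [h3, cycleWeight_eq θ s₁ s₂ (X.svc (k + N) ω), marksAfter_zero_fst, marksAfter_zero_snd,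
        marksAfter_tail, successWeight, if_neg (by simp [hT, hr]), restartWeight,
        if_pos ⟨hT, hr⟩, zero_add, ← mul_assoc, ← ENNReal.ofReal_mul (by positivity),
        ← Real.exp_add]
      congr 3
      ring_nf

/-- If the system is empty at time `0`, the first message to arrive starts service at once, and
nothing departs before it arrives. -/
lemma state_arr_one_of_empty {t a : ℝ} (h0 : X.state 0 ω = .empty) :
    X.state (X.arr 1 ω) ω = .one 0 0 (X.svc 1 ω) ∧
      (0 < t → t ≤ X.arr 1 ω → ¬ X.DepartsAt ω t a) := by
  have hz := X.arr_zero_nonpos ω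
  have ho := X.arr_one_pos ω
  have hadv : (X.state (X.arr 0 ω) ω).advance (0 - X.arr 0 ω) = .empty := by
    rw [← X.state_between 0 0 ω hz (by simpa using ho), h0]
  constructor
  · have := X.state_arrival 0 ω
    rw [zero_add] at this
    have e : X.arr 1 ω - X.arr 0 ω = (0 - X.arr 0 ω) + X.arr 1 ω := by ring
    rw [this, e, State.advance_add ho.le, hadv]
    rfl
  · intro h1 h2
    rw [X.departsAt_iff ω (n := 0) (by linarith) (by simpa using h2)]
    exact State.not_completes_of_advance_eq_empty hadv (by linarith)

/-- If the system is empty at time `0`, the cycle weight computed from the arrivals after time `0`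
describes the first departure: whether it leaves exactly one message behind, the time from the first
arrival, and the age of information. The hypothesis `hage` ensures that messages served before
time `0` are less fresh than the one that departs. -/
lemma first_departure_of_empty (hθ0 : 0 ≤ θ) (h0 : X.state 0 ω = .empty)
    (hage : ∀ t a, X.DepartsAt ω t a → a ≤ t) (s₁ s₂ : ℝ) :
    (if X.numLeft 1 ω = 1 then
        ENNReal.ofReal (Real.exp (-s₁ * (X.dep 1 ω - X.arr 1 ω - X.age (X.dep 1 ω) ω)) *
          Real.exp (-s₂ * X.age (X.dep 1 ω) ω)) else 0) =
      cycleWeight θ s₁ s₂ (future X.arr X.svc ω 0).2 fun j => future X.arr X.svc ω (j + 1) := by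
  classical
  have hst := (X.state_arr_one_of_empty ω (t := 0) (a := 0) h0).1
  have hno := fun t a => (X.state_arr_one_of_empty ω (t := t) (a := a) h0).2
  have ho := X.arr_one_pos ω
  have hex : ∃ N : ℕ, ¬ (X.arr (1 + N + 1) ω - X.arr (1 + N) ω ≤ θ ∧
      X.arr (1 + N + 1) ω - X.arr (1 + N) ω < X.svc (1 + N) ω) := by
    by_contra hc
    push Not at hc
    obtain ⟨a, ha⟩ := (X.exists_dep_eq_iff ω).1 ⟨1, rfl⟩
    obtain ⟨b, hb⟩ := ((X.arr_atTop ω).eventually_ge_atTop (X.dep 1 ω)).exists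
    have hb' : X.dep 1 ω ≤ X.arr (1 + (b.toNat : ℤ)) ω :=
      hb.trans ((X.arr_strictMono ω).monotone (by omega : b ≤ 1 + (b.toNat : ℤ)))
    rcases le_or_gt (X.dep 1 ω) (X.arr 1 ω) with h | h
    · exact hno _ _ (X.dep_one_pos ω) h ha
    · exact (X.run_of_preempt ω 0 0 hst b.toNat fun j _ => hc j).2.1 _ _ h hb' ha
  obtain ⟨N, hN, hmin⟩ := Nat.findX hex
  obtain ⟨h1, h2, h3⟩ := X.run_of_preempt ω s₁ s₂ hst N fun j hj => not_not.1 (hmin j hj)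
  obtain ⟨h4, h5, h6, h7⟩ := X.departure_of_not_preempt ω hθ0 h1 hN
  set K : ℤ := 1 + N with hK
  have hr := X.svc_pos K ω
  have hK1 : X.arr 1 ω ≤ X.arr K ω := (X.arr_strictMono ω).monotone (by omega : (1 : ℤ) ≤ K)
  have hno' : ∀ t a, 0 < t → t < X.arr K ω + X.svc K ω → ¬ X.DepartsAt ω t a := by
    intro t a ht ht'
    rcases le_or_gt t (X.arr 1 ω) with h | h
    · exact hno t a ht h
    rcases le_or_gt t (X.arr K ω) with h' | h'
    · exact h2 t a h h'
    · exact h5 t a h' ht'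
  have hdep : X.dep 1 ω = X.arr K ω + X.svc K ω :=
    X.dep_one_eq ω (by linarith) h4 hno'
  -- the departing message is the freshest one served so far
  have hgr : IsGreatest {a | ∃ t' ≤ X.dep 1 ω, X.DepartsAt ω t' a} (X.arr K ω) := by
    refine ⟨⟨_, le_rfl, hdep ▸ h4⟩, ?_⟩
    rintro a ⟨t, ht, hta⟩
    rcases le_or_gt t 0 with h | h
    · linarith [hage t a hta]
    · rcases ht.lt_or_eq with h' | rfl
      · exact absurd hta (hno' t a h (hdep ▸ h'))
      · exact (h6 a (hdep ▸ hta)).le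
  have hageK : X.age (X.dep 1 ω) ω = X.svc K ω := by
    have : X.age (X.dep 1 ω) ω = X.dep 1 ω - X.arr K ω := by
      rw [age, hgr.csSup_eq]
    rw [this, hdep]
    ring
  have hcw : cycleWeight θ s₁ s₂ (X.svc K ω) (X.marksAfter ω K) =
      if X.arr (K + 1) ω - X.arr K ω ≤ X.svc K ω then
        ENNReal.ofReal (Real.exp (-s₂ * X.svc K ω)) else 0 := by
    rw [cycleWeight_eq, marksAfter_zero_fst, restartWeight, if_neg hN, zero_mul, add_zero,
      successWeight]
    simp only [hN, not_false_eq_true, true_and]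
  have hfs : (future X.arr X.svc ω 0).2 = X.svc 1 ω := by simp [future]
  rw [future_tail, hfs, h3, hcw, numLeft, hageK, hdep, h7]
  by_cases hc : X.arr (K + 1) ω - X.arr K ω ≤ X.svc K ω
  · simp only [hc, if_true]
    rw [ENNReal.ofReal_mul (by positivity)]
    congr 4
    ring
  · simp [hc]

/-- Arbitrarily far in the past there are interarrival times greater than `θ`. The recursion for the
state alone does not exclude a waiting message without an arrival time, present since the infinite
past behind a message that is replaced at every arrival; long gaps do. -/
def HasLongGaps : Prop := ∀ m : ℤ, ∃ n ≤ m, θ < X.arr (n + 1) ω - X.arr n ω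

/-- If a waiting message is only found behind a message that can no longer be pushed out, the same
holds after an arrival, and the waiting message then is the new one. -/
lemma served_of_arrive_eq_two {S : State} {x a u r a' r' : ℝ}
    (hS : ∀ a u r a' r', S = .two a u r a' r' → θ < u)
    (h : S.arrive θ x = .two a u r a' r') : θ < u ∧ a' = 0 := by
  cases S with
  | empty => simp [State.arrive] at h
  | one b v q =>
    by_cases hv : v ≤ θ
    · simp [State.arrive, hv] at h
    · simp only [State.arrive, hv, if_false, State.two.injEq] at h
      obtain ⟨-, rfl, -, rfl, -⟩ := h
      exact ⟨not_le.1 hv, rfl⟩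
  | two b v q b' q' =>
    have := hS _ _ _ _ _ rfl
    simp only [State.arrive, not_le.2 this, if_false, State.two.injEq] at h
    obtain ⟨-, rfl, -, rfl, -⟩ := h
    exact ⟨this, rfl⟩

lemma eq_two_of_advance {S : State} {h a u r a' r' : ℝ}
    (hS : S.advance h = .two a u r a' r') :
    S = .two (a - h) (u - h) r (a' - h) r' := by
  cases S with
  | empty => simp [State.advance] at hS
  | one b v q =>
    by_cases h1 : v + h < q
    · simp [State.advance, h1] at hS
    · simp [State.advance, h1] at hS
  | two b v q b' q' =>
    by_cases h1 : v + h < q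
    · simp only [State.advance, h1, if_true, State.two.injEq] at hS
      obtain ⟨rfl, rfl, rfl, rfl, rfl⟩ := hS
      simp
    · by_cases h2 : v + h - q < q'
      · simp [State.advance, h1, h2] at hS
      · simp [State.advance, h1, h2] at hS

lemma served_nonneg_of_arrive (hθ0 : 0 ≤ θ) {S : State} {x a u r a' r' : ℝ}
    (h : S.arrive θ x = .two a u r a' r') : 0 ≤ u := by
  cases S with
  | empty => simp [State.arrive] at h
  | one b v q =>
    by_cases hv : v ≤ θ
    · simp [State.arrive, hv] at h
    · simp only [State.arrive, hv, if_false, State.two.injEq] at h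
      linarith [h.2.1]
  | two b v q b' q' =>
    by_cases hv : v ≤ θ
    · simp only [State.arrive, hv, if_true, State.two.injEq] at h
      linarith [h.2.1]
    · simp only [State.arrive, hv, if_false, State.two.injEq] at h
      linarith [h.2.1]

lemma state_arr (n : ℤ) : X.state (X.arr n ω) ω =
    ((X.state (X.arr (n - 1) ω) ω).advance (X.arr n ω - X.arr (n - 1) ω)).arrive θ
      (X.svc n ω) := by
  have := X.state_arrival (n - 1) ω
  rwa [sub_add_cancel] at this

lemma age_eq_zero_of_state_arr_eq_one (n : ℤ) {a u r : ℝ}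
    (h : X.state (X.arr n ω) ω = .one a u r) : a = 0 := by
  rw [X.state_arr] at h
  generalize (X.state (X.arr (n - 1) ω) ω).advance _ = S at h
  cases S with
  | empty =>
    simp only [State.arrive, State.one.injEq] at h
    exact h.1.symm
  | one b v q =>
    by_cases hv : v ≤ θ
    · simp only [State.arrive, hv, if_true, State.one.injEq] at h
      exact h.1.symm
    · simp [State.arrive, hv] at h
  | two b v q b' q' =>
    by_cases hv : v ≤ θ <;> simp [State.arrive, hv] at h

/-- If long gaps occur arbitrarily early, a message waits only behind a message that can no longer
be pushed out. -/
lemma served_of_state_arr_eq_two (hθ0 : 0 ≤ θ) (hg : X.HasLongGaps ω) (n : ℤ) {a u r a' r' : ℝ}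
    (h : X.state (X.arr n ω) ω = .two a u r a' r') : θ < u ∧ a' = 0 := by
  obtain ⟨m, hm, hgap⟩ := hg (n - 1)
  have key : ∀ j : ℕ, ∀ a u r a' r',
      X.state (X.arr (m + 1 + j) ω) ω = .two a u r a' r' → θ < u ∧ a' = 0 := by
    intro j
    induction j with
    | zero =>
      intro a u r a' r' h
      simp only [Nat.cast_zero, add_zero] at h
      rw [X.state_arrival] at h
      refine served_of_arrive_eq_two (fun b v q b' q' hS => ?_) h
      have h1 := eq_two_of_advance hS
      rw [X.state_arr] at h1
      have := served_nonneg_of_arrive hθ0 h1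
      linarith
    | succ j ih =>
      intro a u r a' r' h
      have e : m + 1 + ((j + 1 : ℕ) : ℤ) = m + 1 + j + 1 := by push_cast; ring
      rw [e, X.state_arrival] at h
      refine served_of_arrive_eq_two (fun b v q b' q' hS => ?_) h
      have := (ih _ _ _ _ _ (eq_two_of_advance hS)).1
      linarith [X.arr_lt_arr_succ ω (m + 1 + j)]
  obtain ⟨j, hj⟩ := Int.le.dest (by omega : m + 1 ≤ n)
  exact key j _ _ _ _ _ (hj ▸ h)

/-- A message in cell 1 has arrived: followed backwards in time, its received service would
otherwise decrease below `θ` while it stays in cell 1, and an arrival would have pushed it out. -/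
lemma age_nonneg_of_state_arr_eq_two (hθ0 : 0 ≤ θ) (hg : X.HasLongGaps ω) (n : ℤ)
    {a u r a' r' : ℝ} (h : X.state (X.arr n ω) ω = .two a u r a' r') : 0 ≤ a := by
  by_contra ha
  rw [not_le] at ha
  -- a message of negative age would have been in cell 1 at all earlier arrivals
  have key : ∀ j : ℕ, ∃ a' r', X.state (X.arr (n - j) ω) ω =
      .two (a - (X.arr n ω - X.arr (n - j) ω)) (u - (X.arr n ω - X.arr (n - j) ω)) r a' r' := by
    intro j
    induction j with
    | zero => exact ⟨a', r', by simpa using h⟩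
    | succ j ih =>
      obtain ⟨b', q', hb⟩ := ih
      have e : n - ((j + 1 : ℕ) : ℤ) = n - j - 1 := by push_cast; ring
      rw [e]
      have hlt : X.arr (n - j - 1) ω < X.arr (n - j) ω :=
        X.arr_strictMono ω (by simp : n - (j : ℤ) - 1 < n - j)
      have hle : X.arr (n - j) ω ≤ X.arr n ω :=
        (X.arr_strictMono ω).monotone (by simp : n - (j : ℤ) ≤ n)
      rw [X.state_arr] at hb
      have hclean := fun a u r a' r' => X.served_of_state_arr_eq_two ω hθ0 hg (n - j - 1)
        (a := a) (u := u) (r := r) (a' := a') (r' := r')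
      have hone := fun a u r => X.age_eq_zero_of_state_arr_eq_one ω (n - j - 1)
        (a := a) (u := u) (r := r)
      generalize X.state (X.arr (n - j - 1) ω) ω = S at hb hclean hone ⊢
      set d := X.arr (n - j) ω - X.arr (n - j - 1) ω with hd
      have hd' : X.arr n ω - X.arr (n - j - 1) ω = X.arr n ω - X.arr (n - j) ω + d := by
        rw [hd]; ring
      rw [hd']
      set D := X.arr n ω - X.arr (n - j) ω with hD
      have hD0 : 0 ≤ D := by rw [hD]; linarith
      have hd0 : 0 < d := by rw [hd]; linarith
      cases S with
      | empty => simp [State.advance, State.arrive] at hb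
      | one b v q =>
        by_cases h1 : v + d < q
        · by_cases h2 : v + d ≤ θ
          · simp [State.advance, h1, State.arrive, h2] at hb
          · simp only [State.advance, h1, State.arrive, h2, if_true, if_false,
              State.two.injEq] at hb
            have := hone _ _ _ rfl
            linarith [hb.1]
        · simp [State.advance, h1, State.arrive] at hb
      | two b v q b'' q'' =>
        obtain ⟨h3, rfl⟩ := hclean _ _ _ _ _ rfl
        by_cases h1 : v + d < q
        · have h2 : ¬ v + d ≤ θ := by linarith
          simp only [State.advance, h1, State.arrive, h2, if_true, if_false,
            State.two.injEq] at hb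
          refine ⟨0, q'', ?_⟩
          simp only [State.two.injEq, and_true]
          obtain ⟨e1, e2, e3, -, -⟩ := hb
          exact ⟨by linarith, by linarith, e3⟩
        · by_cases h2 : v + d - q < q''
          · by_cases h4 : v + d - q ≤ θ
            · simp [State.advance, h1, h2, State.arrive, h4] at hb
            · simp only [State.advance, h1, h2, State.arrive, h4, if_true, if_false,
                State.two.injEq] at hb
              linarith [hb.1]
          · simp [State.advance, h1, h2, State.arrive] at hb
  obtain ⟨c, hc⟩ := ((X.arr_atBot ω).eventually_lt_atBot (X.arr n ω - u)).exists
  obtain ⟨b', q', hj⟩ := key (n - c).toNat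
  have h1 := (X.served_of_state_arr_eq_two ω hθ0 hg _ hj).1
  have h2 : X.arr (n - ((n - c).toNat : ℤ)) ω ≤ X.arr c ω :=
    (X.arr_strictMono ω).monotone (by omega : n - ((n - c).toNat : ℤ) ≤ c)
  linarith

/-- No message departs before it arrives. -/
lemma le_of_departsAt (hθ0 : 0 ≤ θ) (hg : X.HasLongGaps ω) {t a : ℝ}
    (h : X.DepartsAt ω t a) : a ≤ t := by
  obtain ⟨n, h1, -, h3⟩ := h
  have h1' : X.arr n ω < t := h1
  have h3' : (X.state (X.arr n ω) ω).Completes (t - X.arr n ω) (t - a) := h3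
  rcases hS : X.state (X.arr n ω) ω with _ | ⟨b, v, q⟩ | ⟨b, v, q, b', q'⟩
  · rw [hS] at h3'
    exact h3'.elim
  · rw [hS] at h3'
    have := X.age_eq_zero_of_state_arr_eq_one ω n hS
    linarith [h3'.2]
  · rw [hS] at h3'
    have e1 := (X.served_of_state_arr_eq_two ω hθ0 hg n hS).2
    have e2 := X.age_nonneg_of_state_arr_eq_two ω hθ0 hg n hS
    rcases h3' with ⟨-, h⟩ | ⟨-, h⟩ <;> linarith

end StationarySystem

/-! ### Time shifts and idle periods -/

lemma apply_succ_le_of_range_subset {f g : ℤ → ℝ} (hf : StrictMono f) (hg : StrictMono g)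
    (h : range f ⊆ range g) {n : ℤ} (hn : f n = g n) :
    g (n + 1) ≤ f (n + 1) ∧ f (n - 1) ≤ g (n - 1) := by
  constructor
  · obtain ⟨j, hj⟩ := h ⟨n + 1, rfl⟩
    have h1 : g n < g j := by rw [hj, ← hn]; exact hf (by omega)
    rw [← hj]
    exact hg.monotone (by have := hg.lt_iff_lt.1 h1; omega)
  · obtain ⟨j, hj⟩ := h ⟨n - 1, rfl⟩
    have h1 : g j < g n := by rw [hj, ← hn]; exact hf (by omega)
    rw [← hj]
    exact hg.monotone (by have := hg.lt_iff_lt.1 h1; omega)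

/-- A bi-infinite increasing enumeration of a set of reals is determined by the set and the
position of the index `0`. -/
lemma eq_of_strictMono_of_range_eq {f g : ℤ → ℝ} (hf : StrictMono f) (hg : StrictMono g)
    (h : range f = range g) {c : ℝ} (hf0 : f 0 ≤ c) (hf1 : c < f 1) (hg0 : g 0 ≤ c)
    (hg1 : c < g 1) (n : ℤ) : f n = g n := by
  have aux : ∀ {f g : ℤ → ℝ}, StrictMono f → StrictMono g → range f ⊆ range g → f 0 ≤ c →
      c < g 1 → f 0 ≤ g 0 := by
    intro f g hf hg h hf0 hg1
    obtain ⟨j, hj⟩ := h ⟨0, rfl⟩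
    have h1 : g j < g 1 := by rw [hj]; exact hf0.trans_lt hg1
    rw [← hj]
    exact hg.monotone (by have := hg.lt_iff_lt.1 h1; omega)
  induction n with
  | zero => exact le_antisymm (aux hf hg h.le hf0 hg1) (aux hg hf h.ge hg0 hf1)
  | succ n ih =>
    exact le_antisymm (apply_succ_le_of_range_subset hg hf h.ge ih.symm).1
      (apply_succ_le_of_range_subset hf hg h.le ih).1
  | pred n ih =>
    exact le_antisymm (apply_succ_le_of_range_subset hf hg h.le ih).2
      (apply_succ_le_of_range_subset hg hf h.ge ih.symm).2

namespace StationarySystem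

variable {Ω : Type*} [MeasurableSpace Ω] {P : Measure Ω} {lam : ℝ} {G : Measure ℝ} {θ : ℝ}
variable (X : StationarySystem P lam G θ) (ω : Ω)

lemma departsAt_flow {t u a : ℝ} :
    X.DepartsAt (X.flow t ω) u a ↔ X.DepartsAt ω (u + t) (a + t) := by
  obtain ⟨k, hk⟩ := X.arr_flow t ω
  have e : ∀ n, X.state (X.arr n (X.flow t ω)) (X.flow t ω) = X.state (X.arr (n + k) ω) ω := by
    intro n
    rw [X.state_flow, (hk n).1, sub_add_cancel]
  constructor
  · rintro ⟨n, h1, h2, h3⟩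
    dsimp only at h1 h2 h3
    rw [(hk _).1] at h1 h2
    rw [e, (hk n).1] at h3
    refine ⟨n + k, ?_, ?_, ?_⟩
    · dsimp only; linarith
    · dsimp only; rw [add_right_comm]; linarith
    · dsimp only
      convert h3 using 1 <;> ring
  · rintro ⟨n, h1, h2, h3⟩
    dsimp only at h1 h2 h3
    refine ⟨n - k, ?_, ?_, ?_⟩
    · dsimp only; rw [(hk _).1, sub_add_cancel]; linarith
    · dsimp only; rw [(hk _).1, show n - k + 1 + k = n + 1 by ring]; linarith
    · dsimp only
      rw [e, (hk _).1, sub_add_cancel]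
      convert h3 using 1 <;> ring

lemma exists_dep_le_lt (t : ℝ) : ∃ m, X.dep m ω ≤ t ∧ t < X.dep (m + 1) ω := by
  have key : ∀ i, ∃ j, X.dep j ω = X.dep i (X.flow t ω) + t := by
    intro i
    obtain ⟨a, ha⟩ := (X.exists_dep_eq_iff (X.flow t ω)).1 ⟨i, rfl⟩
    rw [departsAt_flow] at ha
    exact (X.exists_dep_eq_iff ω).2 ⟨_, ha⟩
  obtain ⟨c, hc⟩ := key 0
  obtain ⟨b, hb⟩ := key 1
  have hc' : X.dep c ω ≤ t := by linarith [X.dep_zero_nonpos (X.flow t ω)]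
  have hb' : t < X.dep b ω := by linarith [X.dep_one_pos (X.flow t ω)]
  obtain ⟨n, hn, hmax⟩ := Int.exists_greatest_of_bdd (P := fun n => X.dep n ω ≤ t)
    ⟨b, fun z hz => le_of_lt ((X.dep_strictMono ω).lt_iff_lt.1 (lt_of_le_of_lt hz hb'))⟩ ⟨c, hc'⟩
  refine ⟨n, hn, ?_⟩
  by_contra h
  have := hmax _ (not_lt.1 h)
  omega

lemma dep_flow {t : ℝ} {m : ℤ} (h1 : X.dep m ω ≤ t) (h2 : t < X.dep (m + 1) ω) (j : ℤ) :
    X.dep j (X.flow t ω) = X.dep (m + j) ω - t := by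
  refine eq_of_strictMono_of_range_eq (X.dep_strictMono _) (g := fun j => X.dep (m + j) ω - t)
    ?_ ?_ (X.dep_zero_nonpos _) (X.dep_one_pos _) (by simpa using h1) (by simpa using h2) j
  · intro i j hij
    have := X.dep_strictMono ω (by omega : m + i < m + j)
    dsimp only at this ⊢
    linarith
  · ext u
    constructor
    · rintro ⟨i, hi⟩
      obtain ⟨a, ha⟩ := (X.exists_dep_eq_iff (X.flow t ω)).1 ⟨i, hi⟩
      obtain ⟨l, hl⟩ := (X.exists_dep_eq_iff ω).2 ⟨_, (X.departsAt_flow ω).1 ha⟩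
      refine ⟨l - m, ?_⟩
      dsimp only
      rw [add_sub_cancel, hl, add_sub_cancel_right]
    · rintro ⟨i, hi⟩
      dsimp only at hi
      obtain ⟨a, ha⟩ := (X.exists_dep_eq_iff ω).1 ⟨m + i, rfl⟩
      have h : X.DepartsAt (X.flow t ω) u (a - t) := by
        rw [departsAt_flow, ← hi]
        simpa using ha
      exact (X.exists_dep_eq_iff _).2 ⟨_, h⟩

lemma dep_flow_dep (n j : ℤ) :
    X.dep j (X.flow (X.dep n ω) ω) = X.dep (n + j) ω - X.dep n ω :=
  X.dep_flow ω le_rfl (X.dep_strictMono ω (by omega : n < n + 1)) j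

lemma age_flow (hage : ∀ t a, X.DepartsAt ω t a → a ≤ t) (t u : ℝ) :
    X.age u (X.flow t ω) = X.age (u + t) ω := by
  set A := {a | ∃ t' ≤ u, X.DepartsAt (X.flow t ω) t' a} with hA
  have h : {a | ∃ t' ≤ u + t, X.DepartsAt ω t' a} = OrderIso.addRight t '' A := by
    ext a
    constructor
    · rintro ⟨t', h1, h2⟩
      refine ⟨a - t, ⟨t' - t, by linarith, ?_⟩, by simp⟩
      rw [departsAt_flow]
      simpa using h2
    · rintro ⟨b, ⟨t', h1, h2⟩, rfl⟩
      exact ⟨t' + t, by linarith, (X.departsAt_flow ω).1 h2⟩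
  have hne : A.Nonempty := by
    obtain ⟨m, hm, -⟩ := X.exists_dep_le_lt (X.flow t ω) u
    obtain ⟨a, ha⟩ := (X.exists_dep_eq_iff (X.flow t ω)).1 ⟨m, rfl⟩
    exact ⟨a, _, hm, ha⟩
  have hbdd : BddAbove A := by
    refine ⟨u, ?_⟩
    rintro a ⟨t', h1, h2⟩
    have := hage _ _ ((X.departsAt_flow ω).1 h2)
    linarith
  have h' : sSup {a | ∃ t' ≤ u + t, X.DepartsAt ω t' a} = sSup A + t := by
    rw [h]
    exact ((OrderIso.addRight t).map_csSup' hne hbdd).symm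
  rw [age, age, h']
  ring

lemma hasLongGaps_flow (t : ℝ) : X.HasLongGaps (X.flow t ω) ↔ X.HasLongGaps ω := by
  obtain ⟨k, hk⟩ := X.arr_flow t ω
  constructor
  · intro h m
    obtain ⟨n, hn, hgap⟩ := h (m - k)
    refine ⟨n + k, by omega, ?_⟩
    rw [(hk _).1, (hk _).1, show n + 1 + k = n + k + 1 by ring] at hgap
    linarith
  · intro h m
    obtain ⟨n, hn, hgap⟩ := h (m + k)
    refine ⟨n - k, by omega, ?_⟩
    rw [(hk _).1, (hk _).1, show n - k + 1 + k = n + 1 by ring, sub_add_cancel]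
    linarith

end StationarySystem

lemma State.exists_completes_of_advance_eq_empty {S : State} {d d' : ℝ}
    (h : S.advance d ≠ .empty) (h' : S.advance d' = .empty) :
    ∃ e b, d < e ∧ e ≤ d' ∧ S.Completes e b := by
  cases S with
  | empty => exact absurd rfl h
  | one a u r =>
    by_cases h1 : u + d < r
    · by_cases h2 : u + d' < r
      · simp [advance, h2] at h'
      · exact ⟨r - u, a + (r - u), by linarith, by linarith, by simp, rfl⟩
    · simp [advance, h1] at h
  | two a u r a' r' =>
    by_cases h2 : u + d' < r
    · simp [advance, h2] at h'
    by_cases h1 : u + d < r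
    · exact ⟨r - u, a + (r - u), by linarith, by linarith, Or.inl ⟨by simp, rfl⟩⟩
    by_cases h3 : u + d - r < r'
    · by_cases h4 : u + d' - r < r'
      · simp [advance, h2, h4] at h'
      · exact ⟨r + r' - u, a' + (r + r' - u), by linarith, by linarith, Or.inr ⟨by ring, rfl⟩⟩
    · simp [advance, h1, h3] at h

lemma State.arrive_ne_empty (θ x : ℝ) (S : State) : S.arrive θ x ≠ .empty := by
  cases S <;> simp only [arrive, ne_eq] <;> try split_ifs
  all_goals simp

namespace StationarySystem

variable {Ω : Type*} [MeasurableSpace Ω] {P : Measure Ω} {lam : ℝ} {G : Measure ℝ} {θ : ℝ}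
variable (X : StationarySystem P lam G θ) (ω : Ω)

/-- The system empties only through departures. -/
lemma exists_departsAt_of_state_eq_empty {u v : ℝ} (huv : u ≤ v) (hu : X.state u ω ≠ .empty)
    (hv : X.state v ω = .empty) : ∃ t a, u < t ∧ t ≤ v ∧ X.DepartsAt ω t a := by
  obtain ⟨n, h1, h2⟩ := X.exists_arr_le_lt ω v
  obtain ⟨w, hw1, hw2, hw3, hw⟩ :
      ∃ w, X.arr n ω ≤ w ∧ u ≤ w ∧ w ≤ v ∧ X.state w ω ≠ .empty := by
    rcases le_or_gt (X.arr n ω) u with h | h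
    · exact ⟨u, h, le_rfl, huv, hu⟩
    · refine ⟨X.arr n ω, le_rfl, h.le, h1, ?_⟩
      rw [X.state_arr]
      exact State.arrive_ne_empty _ _ _
  rw [X.state_between n w ω hw1 (by linarith)] at hw
  rw [X.state_between n v ω h1 h2] at hv
  obtain ⟨e, b, h3, h4, h5⟩ := State.exists_completes_of_advance_eq_empty hw hv
  refine ⟨X.arr n ω + e, X.arr n ω + e - b, by linarith, by linarith, ?_⟩
  rw [X.departsAt_iff ω (n := n) (by linarith) (by linarith)]
  convert h5 using 1 <;> ring

lemma not_departsAt_of_lt_dep_one {t a : ℝ} (h0 : 0 < t) (h1 : t < X.dep 1 ω) :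
    ¬ X.DepartsAt ω t a := by
  intro h
  obtain ⟨j, rfl⟩ := (X.exists_dep_eq_iff ω).2 ⟨a, h⟩
  have h2 := (X.dep_strictMono ω).lt_iff_lt.1 h1
  have h3 : X.dep j ω ≤ X.dep 0 ω := (X.dep_strictMono ω).monotone (by omega)
  linarith [X.dep_zero_nonpos ω]

lemma arr_one_le_dep_one (h0 : X.state 0 ω = .empty) : X.arr 1 ω ≤ X.dep 1 ω := by
  by_contra h
  obtain ⟨a, ha⟩ := (X.exists_dep_eq_iff ω).1 ⟨1, rfl⟩
  exact (X.state_arr_one_of_empty ω h0).2 (X.dep_one_pos ω) (not_le.1 h).le ha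

/-- Before the first departure the system is empty exactly up to the first arrival, and this only
if it was empty initially. -/
lemma state_eq_empty_iff {v : ℝ} (h0 : 0 ≤ v) (h1 : v < X.dep 1 ω) :
    X.state v ω = .empty ↔ X.state 0 ω = .empty ∧ v < X.arr 1 ω := by
  have hno : ∀ u, 0 ≤ u → u ≤ v → X.state v ω = .empty → X.state u ω = .empty := by
    intro u hu huv hv
    by_contra hc
    obtain ⟨t, a, h3, h4, h5⟩ := X.exists_departsAt_of_state_eq_empty ω huv hc hv
    exact X.not_departsAt_of_lt_dep_one ω (by linarith) (by linarith) h5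
  constructor
  · intro hv
    refine ⟨hno 0 le_rfl h0 hv, ?_⟩
    by_contra hc
    have := hno _ (X.arr_one_pos ω).le (not_lt.1 hc) hv
    rw [X.state_arr] at this
    exact State.arrive_ne_empty _ _ _ this
  · rintro ⟨h2, h3⟩
    have hz := X.arr_zero_nonpos ω
    rw [X.state_between 0 v ω (hz.trans h0) (by simpa using h3),
      show v - X.arr 0 ω = (0 - X.arr 0 ω) + v by ring, State.advance_add h0,
      ← X.state_between 0 0 ω hz (by simpa using X.arr_one_pos ω), h2]
    rfl

/-- A time shift that skips no arrival does not change the numbering of the arrivals. -/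
lemma arr_flow_of_lt {v : ℝ} (h0 : 0 ≤ v) (h1 : v < X.arr 1 ω) (n : ℤ) :
    X.arr n (X.flow v ω) = X.arr n ω - v ∧ X.svc n (X.flow v ω) = X.svc n ω := by
  obtain ⟨k, hk⟩ := X.arr_flow v ω
  have hk0 : k = 0 := by
    have h2 := X.arr_zero_nonpos (X.flow v ω)
    have h3 := X.arr_one_pos (X.flow v ω)
    rw [(hk _).1] at h2 h3
    have h4 := (X.arr_strictMono ω).lt_iff_lt.1
      (show X.arr (0 + k) ω < X.arr 1 ω by linarith)
    have h5 := (X.arr_strictMono ω).lt_iff_lt.1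
      (show X.arr 0 ω < X.arr (1 + k) ω by linarith [X.arr_zero_nonpos ω])
    omega
  subst hk0
  simpa using hk n

lemma future_flow_of_lt {v : ℝ} (h0 : 0 ≤ v) (h1 : v < X.arr 1 ω) :
    (future X.arr X.svc (X.flow v ω) 0).2 = (future X.arr X.svc ω 0).2 ∧
    ∀ j, future X.arr X.svc (X.flow v ω) (j + 1) = future X.arr X.svc ω (j + 1) := by
  have h := X.arr_flow_of_lt ω h0 h1
  constructor
  · simp [future, (h _).2]
  · intro j
    simp [future, (h _).2, (h _).1]

end StationarySystem

/-! ### The inversion formula of Palm calculus -/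

namespace State

lemma measurable_code : Measurable code := comap_measurable _

lemma measurable_count : Measurable count := by
  have h : count = Sum.elim (fun _ => 0) (Sum.elim (fun _ => 1) fun _ => 2) ∘ code := by
    funext S
    cases S <;> rfl
  rw [h]
  exact (measurable_const.sumElim (measurable_const.sumElim measurable_const)).comp
    measurable_code

lemma count_eq_zero_iff {S : State} : S.count = 0 ↔ S = empty := by
  cases S <;> simp [count]

lemma measurableSet_empty : MeasurableSet {S : State | S = empty} := by
  have h : {S : State | S = empty} = count ⁻¹' {0} := by
    ext S
    simp [count_eq_zero_iff]
  rw [h]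
  exact measurable_count (measurableSet_singleton 0)

lemma measurableSet_advance_eq_empty (h : ℝ) :
    MeasurableSet {S : State | S.advance h = empty} := by
  have e : {S : State | S.advance h = empty} = code ⁻¹' (range Sum.inl ∪
      Sum.inr '' (Sum.inl '' {p : ℝ × ℝ × ℝ | p.2.2 ≤ p.2.1 + h}) ∪
      Sum.inr '' (Sum.inr '' ({p : ℝ × ℝ × ℝ × ℝ × ℝ | p.2.2.1 ≤ p.2.1 + h} ∩
        {p : ℝ × ℝ × ℝ × ℝ × ℝ | p.2.2.2.2 ≤ p.2.1 + h - p.2.2.1}))) := by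
    ext S
    cases S with
    | empty => simp [advance, code]
    | one a u r => by_cases h1 : u + h < r <;> simp [advance, code, h1, not_le.2, not_lt.1]
    | two a u r a' r' =>
      by_cases h1 : u + h < r
      · simp [advance, code, h1]
      · by_cases h2 : u + h - r < r'
        · simp [advance, code, h1, h2]
        · simp [advance, code, h1, h2, not_lt.1 h1, not_lt.1 h2]
  rw [e]
  refine measurable_code ((measurableSet_range_inl.union ?_).union ?_)
  · exact (measurableSet_le (by fun_prop) (by fun_prop)).inl_image.inr_image
  · exact ((measurableSet_le (by fun_prop) (by fun_prop)).inter
      (measurableSet_le (by fun_prop) (by fun_prop))).inr_image.inr_image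

/-- Without arrivals the system empties. -/
lemma exists_nat_advance_eq_empty (S : State) : ∃ N : ℕ, S.advance N = empty := by
  cases S with
  | empty => exact ⟨0, rfl⟩
  | one a u r =>
    obtain ⟨N, hN⟩ := exists_nat_ge (r - u)
    exact ⟨N, by simp [advance]; linarith⟩
  | two a u r a' r' =>
    obtain ⟨N, hN⟩ := exists_nat_ge (max (r - u) (r + r' - u))
    have h1 : ¬ u + N < r := by linarith [(le_max_left _ _).trans hN]
    have h2 : ¬ u + N - r < r' := by linarith [(le_max_right _ _).trans hN]
    exact ⟨N, by simp [advance, h1, h2]⟩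

/-- At most two instants are completion times, if no messages arrive. -/
lemma exists_forall_completes (S : State) :
    ∃ c₁ c₂ : ℝ, ∀ h b, S.Completes h b → h = c₁ ∨ h = c₂ := by
  cases S with
  | empty => exact ⟨0, 0, fun h b hc => hc.elim⟩
  | one a u r => exact ⟨r - u, 0, fun h b hc => Or.inl (by linarith [hc.1])⟩
  | two a u r a' r' =>
    refine ⟨r - u, r + r' - u, fun h b hc => ?_⟩
    rcases hc with ⟨h1, -⟩ | ⟨h1, -⟩
    · exact Or.inl (by linarith)
    · exact Or.inr (by linarith)

end State

namespace StationarySystem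

variable {Ω : Type*} [MeasurableSpace Ω] {P : Measure Ω} {lam : ℝ} {G : Measure ℝ} {θ : ℝ}
variable (X : StationarySystem P lam G θ)

lemma measurable_flow_comp {f : Ω → ℝ} (hf : Measurable f) :
    Measurable fun ω => X.flow (f ω) ω :=
  X.measurable_flow.comp (hf.prodMk measurable_id)

lemma state_zero_flow (t : ℝ) (ω : Ω) : X.state 0 (X.flow t ω) = X.state t ω := by
  rw [X.state_flow, zero_add]

lemma measurable_numLeft (n : ℤ) : Measurable (X.numLeft n) := by
  have h : X.numLeft n = fun ω => (X.state 0 (X.flow (X.dep n ω) ω)).count := by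
    funext ω
    rw [state_zero_flow, numLeft]
  rw [h]
  exact State.measurable_count.comp
    (X.measurable_state.comp (X.measurable_flow_comp (X.measurable_dep n)))

lemma measurable_future : Measurable (future X.arr X.svc) := by
  refine measurable_pi_lambda _ fun n => Measurable.prodMk ?_ (X.measurable_svc _)
  by_cases hn : n = 0
  · simpa [hn] using X.measurable_arr 1
  · simp only [hn, if_false]
    exact (X.measurable_arr _).sub (X.measurable_arr _)

/-- The Palm measure of the departures before normalisation. -/
noncomputable def palmSum : Measure Ω :=
  Measure.sum fun n : ℤ => (P.restrict {ω | 0 < X.dep n ω ∧ X.dep n ω ≤ 1}).map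
    fun ω => X.flow (X.dep n ω) ω

lemma palm_eq : X.palm = X.intensity⁻¹ • X.palmSum := rfl

lemma measurableSet_dep_mem (n : ℤ) : MeasurableSet {ω | 0 < X.dep n ω ∧ X.dep n ω ≤ 1} :=
  (measurableSet_lt measurable_const (X.measurable_dep n)).inter
    (measurableSet_le (X.measurable_dep n) measurable_const)

lemma lintegral_palmSum {f : Ω → ℝ≥0∞} (hf : Measurable f) :
    ∫⁻ ω, f ω ∂X.palmSum = ∑' n : ℤ, ∫⁻ ω in {ω | 0 < X.dep n ω ∧ X.dep n ω ≤ 1},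
      f (X.flow (X.dep n ω) ω) ∂P := by
  rw [palmSum, lintegral_sum_measure]
  exact tsum_congr fun n => lintegral_map hf (X.measurable_flow_comp (X.measurable_dep n))

lemma ae_palmSum {p : Ω → Prop} (hp : MeasurableSet {ω | p ω})
    (h : ∀ n, ∀ᵐ ω ∂P, p (X.flow (X.dep n ω) ω)) : ∀ᵐ ω ∂X.palmSum, p ω := by
  rw [palmSum, Measure.ae_sum_iff]
  intro n
  rw [ae_map_iff (X.measurable_flow_comp (X.measurable_dep n)).aemeasurable hp]
  exact ae_restrict_of_ae (h n)

/-- Inversion formula: a stationary expectation is an integral over the interdeparture interval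
that precedes a typical departure. -/
lemma lintegral_eq_lintegral_palmSum [SFinite P] {Φ : Ω → ℝ≥0∞} (hΦ : Measurable Φ) :
    ∫⁻ ω, Φ ω ∂P = ∫⁻ ω, (∫⁻ v in Ico 0 (X.dep 1 (X.flow (X.dep (-1) ω) ω)),
      Φ (X.flow v (X.flow (X.dep (-1) ω) ω))) ∂X.palmSum := by
  classical
  have hΦf : Measurable fun p : Ω × ℝ => Φ (X.flow p.2 p.1) :=
    hΦ.comp (X.measurable_flow.comp measurable_swap)
  have hH : Measurable fun ω => ∫⁻ v in Ico 0 (X.dep 1 ω), Φ (X.flow v ω) := by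
    have h : (fun ω => ∫⁻ v in Ico 0 (X.dep 1 ω), Φ (X.flow v ω)) =
        fun ω => ∫⁻ v, if 0 ≤ v ∧ v < X.dep 1 ω then Φ (X.flow v ω) else 0 := by
      funext ω
      rw [← lintegral_indicator measurableSet_Ico]
      simp only [indicator, mem_Ico]
    rw [h]
    refine Measurable.lintegral_prod_right' (f := fun p : Ω × ℝ =>
      if 0 ≤ p.2 ∧ p.2 < X.dep 1 p.1 then Φ (X.flow p.2 p.1) else 0) ?_
    refine Measurable.ite ?_ hΦf measurable_const
    exact (measurableSet_le measurable_const measurable_snd).inter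
      (measurableSet_lt measurable_snd ((X.measurable_dep 1).comp measurable_fst))
  have hHB : Measurable fun ω => ∫⁻ v in Ico 0 (X.dep 1 (X.flow (X.dep (-1) ω) ω)),
      Φ (X.flow v (X.flow (X.dep (-1) ω) ω)) :=
    hH.comp (X.measurable_flow_comp (X.measurable_dep (-1)))
  rw [X.lintegral_palmSum hHB]
  have h1 : ∀ (n : ℤ) (ω : Ω), X.flow (X.dep (-1) (X.flow (X.dep n ω) ω))
      (X.flow (X.dep n ω) ω) = X.flow (X.dep (n - 1) ω) ω := by
    intro n ω
    rw [dep_flow_dep, ← X.flow_add, sub_add_cancel, sub_eq_add_neg]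
  have h2 : ∀ (n : ℤ) (ω : Ω), ∫⁻ v in Ico 0 (X.dep 1 (X.flow (X.dep (n - 1) ω) ω)),
      Φ (X.flow v (X.flow (X.dep (n - 1) ω) ω)) =
      ∫⁻ t, if X.dep (n - 1) ω ≤ t ∧ t < X.dep n ω then Φ (X.flow t ω) else 0 := by
    intro n ω
    rw [← lintegral_add_right_eq_self (fun t => if X.dep (n - 1) ω ≤ t ∧ t < X.dep n ω
      then Φ (X.flow t ω) else 0) (X.dep (n - 1) ω), ← lintegral_indicator measurableSet_Ico]
    refine lintegral_congr fun v => ?_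
    rw [dep_flow_dep, sub_add_cancel, indicator]
    simp only [mem_Ico, le_add_iff_nonneg_left, lt_sub_iff_add_lt, X.flow_add]
  have hm : ∀ n : ℤ, Measurable fun p : Ω × ℝ =>
      if (0 < X.dep n p.1 ∧ X.dep n p.1 ≤ 1) ∧ X.dep (n - 1) p.1 ≤ p.2 ∧ p.2 < X.dep n p.1
        then Φ (X.flow p.2 p.1) else 0 := by
    intro n
    have hd := fun n => (X.measurable_dep n).comp
      (measurable_fst : Measurable (Prod.fst : Ω × ℝ → Ω))
    refine Measurable.ite ?_ hΦf measurable_const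
    exact ((measurableSet_lt measurable_const (hd n)).inter
      (measurableSet_le (hd n) measurable_const)).inter
      ((measurableSet_le (hd (n - 1)) measurable_snd).inter
        (measurableSet_lt measurable_snd (hd n)))
  have h3 : ∀ n : ℤ, ∫⁻ ω in {ω | 0 < X.dep n ω ∧ X.dep n ω ≤ 1},
      (∫⁻ t, if X.dep (n - 1) ω ≤ t ∧ t < X.dep n ω then Φ (X.flow t ω) else 0) ∂P =
      ∫⁻ ω, (∫⁻ t, if (0 < X.dep n ω ∧ X.dep n ω ≤ 1) ∧ X.dep (n - 1) ω ≤ t ∧ t < X.dep n ω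
        then Φ (X.flow t ω) else 0) ∂P := by
    intro n
    rw [← lintegral_indicator (X.measurableSet_dep_mem n)]
    refine lintegral_congr fun ω => ?_
    by_cases h : 0 < X.dep n ω ∧ X.dep n ω ≤ 1
    · rw [indicator_of_mem (by exact h)]
      simp only [h, and_self, true_and]
    · rw [indicator_of_notMem (by exact h)]
      simp [h]
  -- the departure that ends the interval containing `t` is at `t + dep 1 (flow t ω)`
  have h4 : ∀ (ω : Ω) (t : ℝ), ∑' n : ℤ,
      (if (0 < X.dep n ω ∧ X.dep n ω ≤ 1) ∧ X.dep (n - 1) ω ≤ t ∧ t < X.dep n ω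
        then Φ (X.flow t ω) else 0) =
      if 0 < t + X.dep 1 (X.flow t ω) ∧ t + X.dep 1 (X.flow t ω) ≤ 1
        then Φ (X.flow t ω) else 0 := by
    intro ω t
    obtain ⟨m, hm1, hm2⟩ := X.exists_dep_le_lt ω t
    rw [tsum_eq_single (m + 1), X.dep_flow ω hm1 hm2, add_sub_cancel]
    · simp [hm1, hm2]
    · intro n hn
      refine if_neg fun hc => hn ?_
      have e1 := (X.dep_strictMono ω).lt_iff_lt.1 (hc.2.1.trans_lt hm2)
      have e2 := (X.dep_strictMono ω).lt_iff_lt.1 (hm1.trans_lt hc.2.2)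
      omega
  have h5 : Measurable fun p : Ω × ℝ =>
      if 0 < p.2 + X.dep 1 p.1 ∧ p.2 + X.dep 1 p.1 ≤ 1 then Φ p.1 else 0 := by
    have hd := measurable_snd.add ((X.measurable_dep 1).comp
      (measurable_fst : Measurable (Prod.fst : Ω × ℝ → Ω)))
    refine Measurable.ite ?_ (hΦ.comp measurable_fst) measurable_const
    exact (measurableSet_lt measurable_const hd).inter (measurableSet_le hd measurable_const)
  have h6 : ∀ t, Measurable fun ω =>
      if 0 < t + X.dep 1 ω ∧ t + X.dep 1 ω ≤ 1 then Φ ω else 0 :=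
    fun t => h5.comp measurable_prodMk_right
  simp only [h1, h2, h3]
  rw [← lintegral_tsum fun n => (hm n).lintegral_prod_right'.aemeasurable]
  have h7 : ∀ ω, ∑' n : ℤ, ∫⁻ t,
      (if (0 < X.dep n ω ∧ X.dep n ω ≤ 1) ∧ X.dep (n - 1) ω ≤ t ∧ t < X.dep n ω
        then Φ (X.flow t ω) else 0) =
      ∫⁻ t, if 0 < t + X.dep 1 (X.flow t ω) ∧ t + X.dep 1 (X.flow t ω) ≤ 1
        then Φ (X.flow t ω) else 0 := by
    intro ω
    have hm' : ∀ n : ℤ, Measurable fun t =>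
        if (0 < X.dep n ω ∧ X.dep n ω ≤ 1) ∧ X.dep (n - 1) ω ≤ t ∧ t < X.dep n ω
          then Φ (X.flow t ω) else 0 := fun n => (hm n).comp measurable_prodMk_left
    rw [← lintegral_tsum fun n => (hm' n).aemeasurable]
    exact lintegral_congr fun t => h4 ω t
  simp only [h7]
  have hsw : Measurable fun p : Ω × ℝ => (X.flow p.2 p.1, p.2) :=
    (X.measurable_flow.comp measurable_swap).prodMk measurable_snd
  rw [lintegral_lintegral_swap (f := fun ω t =>
    if 0 < t + X.dep 1 (X.flow t ω) ∧ t + X.dep 1 (X.flow t ω) ≤ 1 then Φ (X.flow t ω) else 0)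
    (h5.comp hsw).aemeasurable]
  -- for fixed `t`, stationarity removes the shift by `t`
  simp only [fun t => (X.measurePreserving_flow t).lintegral_comp (h6 t)]
  rw [← lintegral_lintegral_swap (f := fun ω t =>
    if 0 < t + X.dep 1 ω ∧ t + X.dep 1 ω ≤ 1 then Φ ω else 0) h5.aemeasurable]
  refine lintegral_congr fun ω => ?_
  have h8 : (fun t => if 0 < t + X.dep 1 ω ∧ t + X.dep 1 ω ≤ 1 then Φ ω else 0) =
      (Ioc (-X.dep 1 ω) (1 - X.dep 1 ω)).indicator fun _ => Φ ω := by
    funext t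
    simp only [indicator, mem_Ioc]
    congr 1
    rw [eq_iff_iff]
    constructor <;> rintro ⟨h, h'⟩ <;> constructor <;> linarith
  rw [h8, lintegral_indicator measurableSet_Ioc, setLIntegral_const, Real.volume_Ioc]
  simp

end StationarySystem

/-! ### Consequences of stationarity -/

/-- An independent identically distributed sequence almost surely does not stay in a set whose
complement has positive measure. -/
lemma infinitePi_forall_mem_eq_zero {α : Type*} [MeasurableSpace α] (μ : Measure α)
    [IsProbabilityMeasure μ] {s : Set α} (hs : MeasurableSet s) (hμ : μ sᶜ ≠ 0) :
    (Measure.infinitePi fun _ : ℕ => μ) {x | ∀ n, x n ∈ s} = 0 := by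
  have h : ∀ N : ℕ, (Measure.infinitePi fun _ : ℕ => μ) {x | ∀ n, x n ∈ s} ≤ μ s ^ N := by
    intro N
    calc (Measure.infinitePi fun _ : ℕ => μ) {x | ∀ n, x n ∈ s}
        ≤ (Measure.infinitePi fun _ : ℕ => μ) (Set.pi (Finset.range N : Set ℕ) fun _ => s) :=
          measure_mono fun x hx n _ => hx n
      _ = μ s ^ N := by
          rw [Measure.infinitePi_pi _ fun _ _ => hs]
          simp
  have h1 : μ s < 1 := by
    refine lt_of_le_of_ne prob_le_one fun h1 => hμ ?_
    rw [prob_compl_eq_zero_iff hs, h1]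
  have h2 := ENNReal.tendsto_pow_atTop_nhds_zero_of_lt_one h1
  exact le_antisymm (ge_of_tendsto' h2 h) zero_le

lemma lintegral_prod_exp_infinitePi {lam : ℝ} (hlam : 0 < lam) (G : Measure ℝ)
    [IsProbabilityMeasure G] (m : ℕ) :
    ∫⁻ x, (∏ j ∈ Finset.range m, ENNReal.ofReal (Real.exp (-1 * (x j).1)))
        ∂(Measure.infinitePi fun _ : ℕ => (expMeasure lam).prod G) =
      ENNReal.ofReal (lam / (lam + 1)) ^ m := by
  have := isProbabilityMeasure_expMeasure hlam
  induction m with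
  | zero => simp
  | succ m ih =>
    have hm : Measurable fun x : ℕ → ℝ × ℝ =>
        ∏ j ∈ Finset.range m, ENNReal.ofReal (Real.exp (-1 * (x j).1)) := by fun_prop
    have hf : Measurable fun T : ℝ => ENNReal.ofReal (Real.exp (-1 * T)) := by fun_prop
    have key := lintegral_infinitePi_head_tail ((expMeasure lam).prod G)
      (f := fun a x => (∏ j ∈ Finset.range m, ENNReal.ofReal (Real.exp (-1 * (x j).1))) *
        ENNReal.ofReal (Real.exp (-1 * a.1)))
      ((hm.comp measurable_snd).mul (hf.comp measurable_fst.fst))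
    simp only [Finset.prod_range_succ']
    rw [key]
    simp only [lintegral_mul_const _ hm, ih]
    have hf1 : Measurable fun a : ℝ × ℝ => ENNReal.ofReal (Real.exp (-1 * a.1)) :=
      hf.comp measurable_fst
    rw [lintegral_const_mul _ hf1, pow_succ]
    congr 1
    rw [lintegral_prod _ hf1.aemeasurable]
    simp only [lintegral_const, measure_univ, mul_one]
    exact lintegral_exp_expMeasure hlam zero_le_one

namespace StationarySystem

variable {Ω : Type*} [MeasurableSpace Ω] {P : Measure Ω} {lam : ℝ} {G : Measure ℝ} {θ : ℝ}
variable (X : StationarySystem P lam G θ)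

lemma lintegral_future {f : (ℕ → ℝ × ℝ) → ℝ≥0∞} (hf : Measurable f) :
    ∫⁻ ω, f (future X.arr X.svc ω) ∂P =
      ∫⁻ x, f x ∂(Measure.infinitePi fun _ : ℕ => (expMeasure lam).prod G) := by
  rw [← X.future_law, lintegral_map hf X.measurable_future]

lemma indepFun_state_future : IndepFun (X.state 0) (future X.arr X.svc) P :=
  X.indep_future.comp measurable_fst measurable_id

lemma measurableSet_state_eq_empty : MeasurableSet {ω | X.state 0 ω = .empty} :=
  X.measurable_state State.measurableSet_empty

/-- What arrives after time `0` does not depend on whether the system is empty at time `0`. -/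
lemma lintegral_empty_future {f : (ℕ → ℝ × ℝ) → ℝ≥0∞} (hf : Measurable f) :
    ∫⁻ ω, {ω | X.state 0 ω = .empty}.indicator (fun ω => f (future X.arr X.svc ω)) ω ∂P =
      P {ω | X.state 0 ω = .empty} *
        ∫⁻ x, f x ∂(Measure.infinitePi fun _ : ℕ => (expMeasure lam).prod G) := by
  have h1 : Measurable fun S : State => {S : State | S = .empty}.indicator (1 : State → ℝ≥0∞) S :=
    measurable_one.indicator State.measurableSet_empty
  have h := lintegral_mul_eq_lintegral_mul_lintegral_of_indepFun
    (h1.comp X.measurable_state) (hf.comp X.measurable_future)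
    (X.indepFun_state_future.comp h1 hf)
  rw [← X.lintegral_future hf, ← lintegral_indicator_one X.measurableSet_state_eq_empty]
  refine Eq.trans (lintegral_congr fun ω => ?_) (h.trans ?_)
  · by_cases hω : X.state 0 ω = .empty <;> simp [indicator, hω]
  · congr 1

/-- The system is empty with positive probability: with positive probability nothing arrives until
the work present at time `0` has been done. -/
lemma measure_state_eq_empty_ne_zero [IsProbabilityMeasure P] [IsProbabilityMeasure G]
    (hlam : 0 < lam) : P {ω | X.state 0 ω = .empty} ≠ 0 := by
  have := isProbabilityMeasure_expMeasure hlam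
  obtain ⟨N, hN⟩ : ∃ N : ℕ, P {ω | (X.state 0 ω).advance N = .empty} ≠ 0 := by
    by_contra hc
    push Not at hc
    have h1 : P (⋃ N : ℕ, {ω | (X.state 0 ω).advance N = .empty}) = 0 := measure_iUnion_null hc
    have h2 : (⋃ N : ℕ, {ω | (X.state 0 ω).advance N = .empty}) = univ := by
      refine eq_univ_of_forall fun ω => ?_
      rw [mem_iUnion]
      exact (X.state 0 ω).exists_nat_advance_eq_empty
    simp [h2] at h1
  have hm : Measurable fun x : ℕ → ℝ × ℝ => (x 0).1 := by fun_prop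
  have hB : MeasurableSet {x : ℕ → ℝ × ℝ | (N : ℝ) < (x 0).1} :=
    measurableSet_lt measurable_const hm
  have hind := X.indepFun_state_future.measure_inter_preimage_eq_mul
    {S : State | S.advance N = .empty} {x : ℕ → ℝ × ℝ | (N : ℝ) < (x 0).1}
    (State.measurableSet_advance_eq_empty N) hB
  have hexp : P (future X.arr X.svc ⁻¹' {x : ℕ → ℝ × ℝ | (N : ℝ) < (x 0).1}) ≠ 0 := by
    rw [← Measure.map_apply X.measurable_future hB, X.future_law]
    have h3 : {x : ℕ → ℝ × ℝ | (N : ℝ) < (x 0).1} =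
        (fun x => x 0) ⁻¹' (Ioi (N : ℝ) ×ˢ (univ : Set ℝ)) := by
      ext x; simp
    have h4 := measurePreserving_eval_infinitePi (fun _ : ℕ => (expMeasure lam).prod G) 0
    rw [h3, h4.measure_preimage (measurableSet_Ioi.prod MeasurableSet.univ).nullMeasurableSet,
      Measure.prod_prod, measure_univ, mul_one]
    exact expMeasure_Ioi_ne_zero hlam (Nat.cast_nonneg N)
  have hpos : P (X.state 0 ⁻¹' {S : State | S.advance N = .empty} ∩
      future X.arr X.svc ⁻¹' {x : ℕ → ℝ × ℝ | (N : ℝ) < (x 0).1}) ≠ 0 := by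
    rw [hind]
    exact mul_ne_zero hN hexp
  rw [← (X.measurePreserving_flow N).measure_preimage
    X.measurableSet_state_eq_empty.nullMeasurableSet]
  refine fun h0 => hpos (measure_mono_null ?_ h0)
  rintro ω ⟨h1, h2⟩
  have h2' : (N : ℝ) < X.arr 1 ω := by simpa [future] using h2
  have hz := X.arr_zero_nonpos ω
  have h1' : (X.state 0 ω).advance N = .empty := h1
  show X.state 0 (X.flow N ω) = .empty
  rw [state_zero_flow, X.state_between 0 N ω (hz.trans (Nat.cast_nonneg N)) (by simpa using h2'),
    show (N : ℝ) - X.arr 0 ω = (0 - X.arr 0 ω) + N by ring, State.advance_add (Nat.cast_nonneg N),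
    ← X.state_between 0 0 ω hz (by simpa using X.arr_one_pos ω), h1']

lemma measurableSet_hasLongGaps : MeasurableSet {ω | X.HasLongGaps ω} := by
  have h : {ω | X.HasLongGaps ω} =
      ⋂ m : ℤ, ⋃ n : ℤ, ⋃ _ : n ≤ m, {ω | θ < X.arr (n + 1) ω - X.arr n ω} := by
    ext ω
    simp [HasLongGaps]
  rw [h]
  exact MeasurableSet.iInter fun m => MeasurableSet.iUnion fun n => MeasurableSet.iUnion fun _ =>
    measurableSet_lt measurable_const ((X.measurable_arr _).sub (X.measurable_arr _))

/-- By stationarity the long gaps, which almost surely occur after time `0`, also occur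
arbitrarily early. -/
lemma ae_hasLongGaps [IsProbabilityMeasure P] [IsProbabilityMeasure G] (hlam : 0 < lam)
    (hθ : 0 ≤ θ) : ∀ᵐ ω ∂P, X.HasLongGaps ω := by
  have := isProbabilityMeasure_expMeasure hlam
  -- some long gap ends at time `t` or earlier
  set B : ℕ → Set Ω := fun t =>
    {ω | ∃ n : ℤ, θ < X.arr (n + 1) ω - X.arr n ω ∧ X.arr (n + 1) ω ≤ t} with hB
  have hBm : Monotone B := by
    rintro s t hst ω ⟨n, h1, h2⟩
    exact ⟨n, h1, h2.trans (by exact_mod_cast hst)⟩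
  have hmeas : ∀ c : ℝ, MeasurableSet
      {ω | ∃ n : ℤ, θ < X.arr (n + 1) ω - X.arr n ω ∧ X.arr (n + 1) ω ≤ c} := by
    intro c
    have h : {ω | ∃ n : ℤ, θ < X.arr (n + 1) ω - X.arr n ω ∧ X.arr (n + 1) ω ≤ c} =
        ⋃ n : ℤ, {ω | θ < X.arr (n + 1) ω - X.arr n ω} ∩ {ω | X.arr (n + 1) ω ≤ c} := by
      ext ω; simp
    rw [h]
    exact MeasurableSet.iUnion fun n =>
      (measurableSet_lt measurable_const ((X.measurable_arr _).sub (X.measurable_arr _))).inter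
        (measurableSet_le (X.measurable_arr _) measurable_const)
  have hU : P (⋃ t, B t) = 1 := by
    have hS : MeasurableSet (Iic θ ×ˢ (univ : Set ℝ)) := measurableSet_Iic.prod MeasurableSet.univ
    have hc : ((expMeasure lam).prod G) (Iic θ ×ˢ (univ : Set ℝ))ᶜ ≠ 0 := by
      have h1 : (Iic θ ×ˢ (univ : Set ℝ))ᶜ = Ioi θ ×ˢ (univ : Set ℝ) := by
        ext p; simp
      rw [h1, Measure.prod_prod, measure_univ, mul_one]
      exact expMeasure_Ioi_ne_zero hlam hθ
    have h0 := infinitePi_forall_mem_eq_zero ((expMeasure lam).prod G) hS hc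
    have hms : MeasurableSet {x : ℕ → ℝ × ℝ | ∀ n, x n ∈ Iic θ ×ˢ (univ : Set ℝ)} := by
      have : {x : ℕ → ℝ × ℝ | ∀ n, x n ∈ Iic θ ×ˢ (univ : Set ℝ)} =
          ⋂ n : ℕ, (fun x => x n) ⁻¹' (Iic θ ×ˢ (univ : Set ℝ)) := by
        ext x; simp
      rw [this]
      exact MeasurableSet.iInter fun n => measurable_pi_apply n hS
    rw [← X.future_law, Measure.map_apply X.measurable_future hms] at h0
    rw [← prob_compl_eq_zero_iff (MeasurableSet.iUnion fun t : ℕ => hmeas t)]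
    refine measure_mono_null ?_ h0
    intro ω hω n
    simp only [mem_compl_iff, mem_iUnion, not_exists] at hω
    simp only [mem_prod, mem_Iic, mem_univ, and_true]
    by_contra hgap
    rw [not_le] at hgap
    obtain ⟨t, ht⟩ := exists_nat_ge (X.arr ((n : ℤ) + 1) ω)
    refine hω t ⟨n, ?_, ht⟩
    by_cases hn : n = 0
    · subst hn
      have := X.arr_zero_nonpos ω
      simp only [future, if_true] at hgap
      simp only [Nat.cast_zero, zero_add]
      linarith
    · simpa [future, hn] using hgap
  have hlim : Tendsto (fun t => P (B t)) atTop (nhds 1) := by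
    rw [← hU]
    exact tendsto_measure_iUnion_atTop hBm
  have hpast : ∀ M : ℕ, ∀ᵐ ω ∂P,
      ∃ n : ℤ, θ < X.arr (n + 1) ω - X.arr n ω ∧ X.arr (n + 1) ω ≤ -(M : ℝ) := by
    intro M
    rw [ae_iff_prob_eq_one (measurableSet_setOfPred.1 (hmeas _))]
    refine le_antisymm prob_le_one (le_of_tendsto' hlim fun t => ?_)
    rw [← (X.measurePreserving_flow (-(t + M : ℝ))).measure_preimage (hmeas t).nullMeasurableSet]
    refine measure_mono ?_
    rintro ω ⟨n, h1, h2⟩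
    obtain ⟨k, hk⟩ := X.arr_flow (-(t + M : ℝ)) ω
    rw [(hk _).1] at h2
    rw [(hk _).1, (hk _).1] at h1
    refine ⟨n + k, ?_, ?_⟩
    · rw [add_right_comm]; linarith
    · rw [add_right_comm]; linarith
  filter_upwards [ae_all_iff.2 hpast] with ω hω m
  obtain ⟨M, hM⟩ := exists_nat_gt (-X.arr (m + 1) ω)
  obtain ⟨n, h1, h2⟩ := hω M
  refine ⟨n, ?_, h1⟩
  have := (X.arr_strictMono ω).lt_iff_lt.1 (show X.arr (n + 1) ω < X.arr (m + 1) ω by linarith)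
  omega

lemma ae_palmSum_hasLongGaps [IsProbabilityMeasure P] [IsProbabilityMeasure G] (hlam : 0 < lam)
    (hθ : 0 ≤ θ) : ∀ᵐ ω ∂X.palmSum, X.HasLongGaps ω := by
  refine X.ae_palmSum X.measurableSet_hasLongGaps fun n => ?_
  filter_upwards [X.ae_hasLongGaps hlam hθ] with ω hω
  exact (X.hasLongGaps_flow ω _).2 hω

lemma sum_future_eq_arr (ω : Ω) (m : ℕ) :
    ∑ j ∈ Finset.range (m + 1), (future X.arr X.svc ω j).1 = X.arr (m + 1) ω := by
  induction m with
  | zero => simp [future]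
  | succ m ih =>
    rw [Finset.sum_range_succ, ih]
    simp [future]

/-- The intensity of the departures is finite: at most two departures happen between successive
arrivals, and the mean number of arrivals in `(0, 1]` is finite. -/
lemma intensity_ne_top [IsProbabilityMeasure G] (hlam : 0 < lam) :
    X.intensity ≠ ∞ := by
  classical
  have h1 : X.intensity = ∫⁻ ω, ∑' n : ℤ,
      {ω | 0 < X.dep n ω ∧ X.dep n ω ≤ 1}.indicator (1 : Ω → ℝ≥0∞) ω ∂P := by
    rw [lintegral_tsum fun n =>
      (measurable_one.indicator (X.measurableSet_dep_mem n)).aemeasurable]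
    simp only [lintegral_indicator_one (X.measurableSet_dep_mem _)]
    rfl
  have h2 : ∀ ω, ∑' n : ℤ, {ω | 0 < X.dep n ω ∧ X.dep n ω ≤ 1}.indicator (1 : Ω → ℝ≥0∞) ω ≤
      ∑' m : ℕ, if X.arr m ω < 1 then (2 : ℝ≥0∞) else 0 := by
    intro ω
    -- the candidates for a departure time between the arrivals `m` and `m + 1`
    choose c₁ c₂ hc using fun m : ℕ => (X.state (X.arr m ω) ω).exists_forall_completes
    have h3 : ∀ n : ℤ, {ω | 0 < X.dep n ω ∧ X.dep n ω ≤ 1}.indicator (1 : Ω → ℝ≥0∞) ω ≤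
        ∑' m : ℕ, if X.arr m ω < 1 then
          ((if X.dep n ω = X.arr m ω + c₁ m then (1 : ℝ≥0∞) else 0) +
            if X.dep n ω = X.arr m ω + c₂ m then (1 : ℝ≥0∞) else 0) else 0 := by
      intro n
      by_cases hn : 0 < X.dep n ω ∧ X.dep n ω ≤ 1
      · obtain ⟨a, ha⟩ := (X.exists_dep_eq_iff ω).1 ⟨n, rfl⟩
        obtain ⟨m, hm1, hm2⟩ := X.exists_arr_lt_le ω (X.dep n ω)
        have hm0 : 0 ≤ m := by
          have := (X.arr_strictMono ω).lt_iff_lt.1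
            ((X.arr_zero_nonpos ω).trans_lt (hn.1.trans_le hm2))
          omega
        lift m to ℕ using hm0
        rw [X.departsAt_iff ω hm1 hm2] at ha
        refine le_trans ?_ (ENNReal.le_tsum m)
        rw [if_pos (hm1.trans_le hn.2), indicator_of_mem (by exact hn)]
        rcases hc m _ _ ha with h | h
        · rw [if_pos (by linarith)]
          exact le_add_right le_rfl
        · rw [if_pos (c := X.dep n ω = X.arr m ω + c₂ m) (by linarith)]
          exact le_add_left le_rfl
      · rw [indicator_of_notMem (by exact hn)]
        exact zero_le
    have h4 : ∀ c : ℝ, ∑' n : ℤ, (if X.dep n ω = c then (1 : ℝ≥0∞) else 0) ≤ 1 := by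
      intro c
      by_cases hj : ∃ j, X.dep j ω = c
      · obtain ⟨j, rfl⟩ := hj
        rw [tsum_eq_single j fun n hn => if_neg fun h => hn ((X.dep_strictMono ω).injective h)]
        simp
      · push Not at hj
        simp [hj]
    calc _ ≤ _ := ENNReal.tsum_le_tsum h3
      _ = _ := ENNReal.tsum_comm
      _ ≤ _ := by
        refine ENNReal.tsum_le_tsum fun m => ?_
        by_cases hm : X.arr m ω < 1
        · simp only [hm, if_true]
          rw [ENNReal.tsum_add, ← one_add_one_eq_two]
          exact add_le_add (h4 _) (h4 _)
        · simp [hm]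
  -- exponential Markov inequality for the time of the arrival with index `m`
  have h5 : ∀ (ω : Ω) (m : ℕ), (if X.arr m ω < 1 then (2 : ℝ≥0∞) else 0) ≤
      ENNReal.ofReal (2 * Real.exp 1) *
        ∏ j ∈ Finset.range m, ENNReal.ofReal (Real.exp (-1 * (future X.arr X.svc ω j).1)) := by
    intro ω m
    split_ifs with hm
    · rw [← ENNReal.ofReal_prod_of_nonneg fun _ _ => (Real.exp_pos _).le, ← Real.exp_sum,
        ← Finset.mul_sum, ← ENNReal.ofReal_mul (by positivity), mul_assoc, ← Real.exp_add]
      have : 0 ≤ 1 + -1 * ∑ j ∈ Finset.range m, (future X.arr X.svc ω j).1 := by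
        cases m with
        | zero => simp
        | succ m =>
          rw [X.sum_future_eq_arr]
          push_cast at hm
          linarith
      rw [← ENNReal.ofReal_ofNat]
      refine ENNReal.ofReal_le_ofReal ?_
      have := Real.one_le_exp this
      linarith
    · exact zero_le
  have hρ : ENNReal.ofReal (lam / (lam + 1)) < 1 := by
    rw [ENNReal.ofReal_lt_one, div_lt_one (by linarith)]
    linarith
  have hprod : ∀ m : ℕ, Measurable fun x : ℕ → ℝ × ℝ =>
      ∏ j ∈ Finset.range m, ENNReal.ofReal (Real.exp (-1 * (x j).1)) := fun m => by fun_prop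
  rw [h1]
  refine ne_top_of_le_ne_top (b := ∫⁻ ω, ∑' m : ℕ, ENNReal.ofReal (2 * Real.exp 1) *
    ∏ j ∈ Finset.range m, ENNReal.ofReal (Real.exp (-1 * (future X.arr X.svc ω j).1)) ∂P) ?_
    (lintegral_mono fun ω => (h2 ω).trans (ENNReal.tsum_le_tsum (h5 ω)))
  have hprodω : ∀ m : ℕ, Measurable fun ω => ∏ j ∈ Finset.range m,
      ENNReal.ofReal (Real.exp (-1 * (future X.arr X.svc ω j).1)) :=
    fun m => (hprod m).comp X.measurable_future
  rw [lintegral_tsum fun m => ((hprodω m).const_mul _).aemeasurable]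
  have h6 : ∀ m : ℕ, ∫⁻ ω, ENNReal.ofReal (2 * Real.exp 1) * ∏ j ∈ Finset.range m,
      ENNReal.ofReal (Real.exp (-1 * (future X.arr X.svc ω j).1)) ∂P =
      ENNReal.ofReal (2 * Real.exp 1) * ENNReal.ofReal (lam / (lam + 1)) ^ m := by
    intro m
    rw [lintegral_const_mul _ (hprodω m),
      X.lintegral_future (hprod m), lintegral_prod_exp_infinitePi hlam]
  simp only [h6]
  rw [ENNReal.tsum_mul_left, ENNReal.tsum_geometric]
  refine ENNReal.mul_ne_top ENNReal.ofReal_ne_top (ENNReal.inv_ne_top.2 ?_)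
  exact (tsub_pos_of_lt hρ).ne'

end StationarySystem

/-! ### The cycle formula -/

lemma lintegral_Ico_exp {s A : ℝ} (hs : 0 ≤ s) (hA : 0 ≤ A) :
    ∫⁻ v in Ico 0 A, ENNReal.ofReal (s * Real.exp (-s * (A - v))) =
      ENNReal.ofReal (1 - Real.exp (-s * A)) := by
  have hc : Continuous fun v => s * Real.exp (-s * (A - v)) := by fun_prop
  rw [setLIntegral_congr Ico_ae_eq_Ioc, ← ofReal_integral_eq_lintegral_ofReal
    (hc.integrableOn_Ioc) (ae_of_all _ fun v => by positivity),
    ← intervalIntegral.integral_of_le hA]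
  congr 1
  have hd : ∀ v ∈ uIcc 0 A, HasDerivAt (fun v => Real.exp (-s * (A - v)))
      (s * Real.exp (-s * (A - v))) v := by
    intro v _
    have h := (((hasDerivAt_id v).const_sub A).const_mul (-s)).exp
    convert! h using 1
    simp only [id]
    ring
  rw [intervalIntegral.integral_eq_sub_of_hasDerivAt hd (hc.intervalIntegrable _ _)]
  simp

lemma cond_smul_measure {Ω : Type*} [MeasurableSpace Ω] (μ : Measure Ω) (E : Set Ω) {k : ℝ≥0∞}
    (h0 : k ≠ 0) (ht : k ≠ ∞) : ProbabilityTheory.cond (k • μ) E = ProbabilityTheory.cond μ E := by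
  rw [ProbabilityTheory.cond, ProbabilityTheory.cond, Measure.smul_apply, smul_eq_mul,
    Measure.restrict_smul, smul_smul, ENNReal.mul_inv (Or.inl h0) (Or.inl ht), mul_right_comm,
    ENNReal.inv_mul_cancel h0 ht, one_mul]

lemma integral_cond_eq_div {Ω : Type*} [MeasurableSpace Ω] (μ : Measure Ω) {E : Set Ω}
    {f : Ω → ℝ} (hf0 : ∀ ω, 0 ≤ f ω) (hf : AEStronglyMeasurable f (μ.restrict E)) :
    ∫ ω, f ω ∂(ProbabilityTheory.cond μ E) =
      (∫⁻ ω in E, ENNReal.ofReal (f ω) ∂μ).toReal / (μ E).toReal := by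
  rw [ProbabilityTheory.cond, integral_smul_measure,
    integral_eq_lintegral_of_nonneg_ae (ae_of_all _ hf0) hf, ENNReal.toReal_inv, smul_eq_mul,
    inv_mul_eq_div]

namespace StationarySystem

variable {Ω : Type*} [MeasurableSpace Ω] {P : Measure Ω} {lam : ℝ} {G : Measure ℝ} {θ : ℝ}
variable (X : StationarySystem P lam G θ)

/-- The weight of the cycle that begins with the first arrival after time `0`, on the event that the
system is empty at time `0`. -/
noncomputable def firstCycle (s₁ s₂ : ℝ) (ω : Ω) : ℝ≥0∞ :=
  {ω | X.state 0 ω = .empty}.indicator (fun ω => cycleWeight θ s₁ s₂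
    (future X.arr X.svc ω 0).2 fun j => future X.arr X.svc ω (j + 1)) ω

lemma measurable_cycleWeight_head_tail (θ s₁ s₂ : ℝ) :
    Measurable fun x : ℕ → ℝ × ℝ => cycleWeight θ s₁ s₂ (x 0).2 fun j => x (j + 1) :=
  (measurable_cycleWeight θ s₁ s₂).comp ((measurable_pi_apply 0).snd.prodMk
    (measurable_pi_lambda _ fun j => measurable_pi_apply (j + 1)))

lemma measurable_firstCycle (s₁ s₂ : ℝ) : Measurable (X.firstCycle s₁ s₂) :=
  ((measurable_cycleWeight_head_tail θ s₁ s₂).comp X.measurable_future).indicator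
    X.measurableSet_state_eq_empty

/-- Up to the first departure, the system is empty exactly during the initial idle period, of length
`arr 1`, and the cycle that follows looks the same from each instant of it. Hence the integral
over `v` is that of the density `s * exp (-s * (arr 1 - v))`. -/
lemma lintegral_idle (s₁ s₂ : ℝ) {s : ℝ} (hs : 0 ≤ s) (ω : Ω) :
    ∫⁻ v in Ico 0 (X.dep 1 ω), {ω | X.state 0 ω = .empty}.indicator (fun ω =>
        ENNReal.ofReal (s * Real.exp (-s * (future X.arr X.svc ω 0).1)) *
          cycleWeight θ s₁ s₂ (future X.arr X.svc ω 0).2 fun j => future X.arr X.svc ω (j + 1))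
        (X.flow v ω) =
      ENNReal.ofReal (1 - Real.exp (-s * X.arr 1 ω)) * X.firstCycle s₁ s₂ ω := by
  have hmem : ∀ v ∈ Ico 0 (X.dep 1 ω), X.flow v ω ∈ {ω | X.state 0 ω = .empty} ↔
      X.state 0 ω = .empty ∧ v < X.arr 1 ω := by
    intro v hv
    rw [mem_ofPred_eq, state_zero_flow, X.state_eq_empty_iff ω hv.1 hv.2]
  by_cases h0 : X.state 0 ω = .empty
  · have hle := X.arr_one_le_dep_one ω h0
    have h1 : ∀ v ∈ Ico 0 (X.dep 1 ω), {ω | X.state 0 ω = .empty}.indicator (fun ω =>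
        ENNReal.ofReal (s * Real.exp (-s * (future X.arr X.svc ω 0).1)) *
          cycleWeight θ s₁ s₂ (future X.arr X.svc ω 0).2 fun j => future X.arr X.svc ω (j + 1))
        (X.flow v ω) = (Ico 0 (X.arr 1 ω)).indicator (fun v =>
          ENNReal.ofReal (s * Real.exp (-s * (X.arr 1 ω - v))) * X.firstCycle s₁ s₂ ω) v := by
      intro v hv
      by_cases hv1 : v < X.arr 1 ω
      · rw [indicator_of_mem ((hmem v hv).2 ⟨h0, hv1⟩),
          indicator_of_mem (show v ∈ Ico 0 (X.arr 1 ω) from ⟨hv.1, hv1⟩), firstCycle,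
          indicator_of_mem (by exact h0)]
        obtain ⟨h2, h3⟩ := X.future_flow_of_lt ω hv.1 hv1
        simp only [h2, h3]
        congr 4
        simp [future, (X.arr_flow_of_lt ω hv.1 hv1 1).1]
      · rw [indicator_of_notMem fun h => hv1 ((hmem v hv).1 h).2,
          indicator_of_notMem fun h => hv1 h.2]
    rw [setLIntegral_congr_fun measurableSet_Ico h1, lintegral_indicator measurableSet_Ico,
      Measure.restrict_restrict measurableSet_Ico,
      inter_eq_left.2 (Ico_subset_Ico_right hle), lintegral_mul_const _ (by fun_prop),
      lintegral_Ico_exp hs (X.arr_one_pos ω).le]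
  · rw [firstCycle, indicator_of_notMem (by exact h0), mul_zero]
    refine (setLIntegral_congr_fun measurableSet_Ico fun v hv => ?_).trans lintegral_zero
    exact indicator_of_notMem (fun h => h0 ((hmem v hv).1 h).1) _

lemma measurable_flow_dep (n : ℤ) : Measurable fun ω => X.flow (X.dep n ω) ω :=
  X.measurable_flow_comp (X.measurable_dep n)

lemma measurable_one_sub_exp_idle (s : ℝ) : Measurable fun ω =>
    ENNReal.ofReal (1 - Real.exp (-s * X.arr 1 (X.flow (X.dep (-1) ω) ω))) := by
  have h1 : Measurable fun ω => X.arr 1 (X.flow (X.dep (-1) ω) ω) :=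
    (X.measurable_arr 1).comp (X.measurable_flow_dep (-1))
  fun_prop

/-- The departures that leave one message behind and end a cycle that began with an empty
system. -/
abbrev cycleEnd : Set Ω := {ω | X.numLeft (-1) ω = 0 ∧ X.numLeft 0 ω = 1}

lemma measurableSet_cycleEnd : MeasurableSet X.cycleEnd :=
  (X.measurable_numLeft (-1) (measurableSet_singleton 0)).inter
    (X.measurable_numLeft 0 (measurableSet_singleton 1))

/-- The mean weight of a cycle times the probability of an empty system; up to the factor `lam`, the
sum of the weights of the cycles per unit of time. -/
noncomputable def cycleRate (s₁ s₂ : ℝ) : ℝ≥0∞ :=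
  P {ω | X.state 0 ω = .empty} * ((1 - restartFactor (expMeasure lam) G θ s₁)⁻¹ *
    successFactor (expMeasure lam) G θ s₂)

section Palm

variable [IsProbabilityMeasure G]

lemma cycleRate_toReal (hlam : 0 < lam) (hθ : 0 ≤ θ) (hGpos : G (Iic 0) = 0) {s₁ : ℝ} (s₂ : ℝ)
    (hs₁ : 0 ≤ s₁) : (X.cycleRate s₁ s₂).toReal = (P {ω | X.state 0 ω = .empty}).toReal *
      ((1 - preemptProb lam G θ * laplace (lawJ lam G θ) s₁)⁻¹ *
        (successFactor (expMeasure lam) G θ s₂).toReal) := by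
  rw [cycleRate, ENNReal.toReal_mul, ENNReal.toReal_mul, ENNReal.toReal_inv,
    ENNReal.toReal_sub_of_le (restartFactor_lt_one hlam hθ hGpos hs₁).le ENNReal.one_ne_top,
    restartFactor_toReal hlam hθ hGpos hs₁, ENNReal.toReal_one]

lemma cycleRate_zero_toReal (hlam : 0 < lam) (hθ : 0 ≤ θ) (hGpos : G (Iic 0) = 0) (s₂ : ℝ) :
    (X.cycleRate 0 s₂).toReal = (P {ω | X.state 0 ω = .empty}).toReal *
      ((1 - preemptProb lam G θ)⁻¹ * (successFactor (expMeasure lam) G θ s₂).toReal) := by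
  rw [X.cycleRate_toReal hlam hθ hGpos s₂ le_rfl, ← restartFactor_toReal hlam hθ hGpos le_rfl,
    restartFactor_zero hlam hθ hGpos, ENNReal.toReal_ofReal (preemptProb_nonneg hlam hθ hGpos)]

variable [IsProbabilityMeasure P]

/-- The inversion formula, applied to the stationary system found empty at time `0`: the time to the
next arrival is exponential and independent of the cycle that follows. -/
lemma lintegral_one_sub_exp_mul_firstCycle (hlam : 0 < lam) (s₁ s₂ : ℝ) {s : ℝ} (hs : 0 ≤ s) :
    ∫⁻ ω, ENNReal.ofReal (1 - Real.exp (-s * X.arr 1 (X.flow (X.dep (-1) ω) ω))) *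
        X.firstCycle s₁ s₂ (X.flow (X.dep (-1) ω) ω) ∂X.palmSum =
      ENNReal.ofReal (s * (lam / (lam + s))) * X.cycleRate s₁ s₂ := by
  have := isProbabilityMeasure_expMeasure hlam
  have hf : Measurable fun T : ℝ => ENNReal.ofReal (s * Real.exp (-s * T)) := by fun_prop
  have hf1 : Measurable fun x : ℕ → ℝ × ℝ => ENNReal.ofReal (s * Real.exp (-s * (x 0).1)) :=
    hf.comp (measurable_pi_apply 0).fst
  have hf2 := hf1.mul (measurable_cycleWeight_head_tail θ s₁ s₂)
  have hΦ : Measurable fun ω => {ω | X.state 0 ω = .empty}.indicator (fun ω =>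
        ENNReal.ofReal (s * Real.exp (-s * (future X.arr X.svc ω 0).1)) *
          cycleWeight θ s₁ s₂ (future X.arr X.svc ω 0).2 fun j => future X.arr X.svc ω (j + 1))
        ω :=
    (hf2.comp X.measurable_future).indicator X.measurableSet_state_eq_empty
  have h := X.lintegral_eq_lintegral_palmSum hΦ
  simp only [X.lintegral_idle s₁ s₂ hs] at h
  have h2 := X.lintegral_empty_future hf2
  simp only [Pi.mul_apply] at h2
  rw [← h, h2, lintegral_mul_cycleWeight (expMeasure lam) G θ s₁ s₂ hf, cycleRate]
  have h3 : ∫⁻ T, ENNReal.ofReal (s * Real.exp (-s * T)) ∂(expMeasure lam) =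
      ENNReal.ofReal (s * (lam / (lam + s))) := by
    simp only [ENNReal.ofReal_mul hs]
    rw [lintegral_const_mul _ (by fun_prop), lintegral_exp_expMeasure hlam hs]
  rw [h3, mul_left_comm]

/-- As `s` tends to infinity, `1 - exp (-s I)` increases to `1`, since idle periods `I` have
positive length. -/
lemma lintegral_firstCycle (hlam : 0 < lam) (s₁ s₂ : ℝ) :
    ∫⁻ ω, X.firstCycle s₁ s₂ (X.flow (X.dep (-1) ω) ω) ∂X.palmSum =
      ENNReal.ofReal lam * X.cycleRate s₁ s₂ := by
  have hm := (X.measurable_firstCycle s₁ s₂).comp (X.measurable_flow_dep (-1))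
  have h1 : Tendsto (fun n : ℕ => ∫⁻ ω, ENNReal.ofReal
      (1 - Real.exp (-(n : ℝ) * X.arr 1 (X.flow (X.dep (-1) ω) ω))) *
        X.firstCycle s₁ s₂ (X.flow (X.dep (-1) ω) ω) ∂X.palmSum) atTop
      (nhds (∫⁻ ω, X.firstCycle s₁ s₂ (X.flow (X.dep (-1) ω) ω) ∂X.palmSum)) := by
    refine lintegral_tendsto_of_tendsto_of_monotone
      (fun n => ((X.measurable_one_sub_exp_idle n).mul hm).aemeasurable) (ae_of_all _ fun ω => ?_)
      (ae_of_all _ fun ω => ?_)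
    · intro m n hmn
      have := X.arr_one_pos (X.flow (X.dep (-1) ω) ω)
      have hmn' : (m : ℝ) ≤ n := by exact_mod_cast hmn
      dsimp only
      gcongr
    · have hpos := X.arr_one_pos (X.flow (X.dep (-1) ω) ω)
      set A := X.arr 1 (X.flow (X.dep (-1) ω) ω)
      have h2 : Tendsto (fun n : ℕ => ENNReal.ofReal (1 - Real.exp (-(n : ℝ) * A))) atTop
          (nhds 1) := by
        rw [← ENNReal.ofReal_one]
        refine ENNReal.tendsto_ofReal ?_
        have h3 : Tendsto (fun n : ℕ => -(n : ℝ) * A) atTop atBot := by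
          simp only [neg_mul]
          exact tendsto_neg_atTop_atBot.comp
            (tendsto_natCast_atTop_atTop.atTop_mul_const hpos)
        simpa using (Real.tendsto_exp_atBot.comp h3).const_sub 1
      simpa using ENNReal.Tendsto.mul_const h2 (Or.inl one_ne_zero)
  have h2 : Tendsto (fun n : ℕ => ENNReal.ofReal ((n : ℝ) * (lam / (lam + n))) *
      X.cycleRate s₁ s₂) atTop (nhds (ENNReal.ofReal lam * X.cycleRate s₁ s₂)) := by
    refine ENNReal.Tendsto.mul_const (ENNReal.tendsto_ofReal ?_)
      (Or.inl (ENNReal.ofReal_pos.2 hlam).ne')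
    have h3 : Tendsto (fun n : ℕ => lam - lam * (lam / (lam + n))) atTop
        (nhds (lam - lam * 0)) :=
      ((tendsto_const_nhds.div_atTop
        (tendsto_atTop_add_const_left _ _ tendsto_natCast_atTop_atTop)).const_mul lam).const_sub lam
    rw [mul_zero, sub_zero] at h3
    refine h3.congr fun n => ?_
    have : lam + n ≠ 0 := by positivity
    field_simp
    ring
  simp only [X.lintegral_one_sub_exp_mul_firstCycle hlam s₁ s₂ (Nat.cast_nonneg _)] at h1
  exact tendsto_nhds_unique h1 h2

lemma cycleRate_ne_top (hlam : 0 < lam) (hθ : 0 ≤ θ) (hGpos : G (Iic 0) = 0) {s₁ s₂ : ℝ}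
    (hs₁ : 0 ≤ s₁) (hs₂ : 0 ≤ s₂) : X.cycleRate s₁ s₂ ≠ ∞ := by
  refine ENNReal.mul_ne_top (measure_ne_top _ _) (ENNReal.mul_ne_top (ENNReal.inv_ne_top.2 ?_)
    (successFactor_ne_top hlam hθ hs₂))
  exact (tsub_pos_of_lt (restartFactor_lt_one hlam hθ hGpos hs₁)).ne'

lemma cycleRate_ne_zero (hlam : 0 < lam) (hθ : 0 ≤ θ) (hGθ : G (Ioi θ) ≠ 0) (s₁ s₂ : ℝ) :
    X.cycleRate s₁ s₂ ≠ 0 := by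
  refine mul_ne_zero (X.measure_state_eq_empty_ne_zero hlam) (mul_ne_zero ?_
    (successFactor_ne_zero hlam hθ hGθ s₂))
  exact ENNReal.inv_ne_zero.2 (ne_top_of_le_ne_top ENNReal.one_ne_top tsub_le_self)

/-- Under the Palm measure, the idle period is exponential and independent of the cycle that
follows. -/
lemma lintegral_exp_mul_firstCycle (hlam : 0 < lam) (hθ : 0 ≤ θ) (hGpos : G (Iic 0) = 0)
    {s₁ s₂ s : ℝ} (hs₁ : 0 ≤ s₁) (hs₂ : 0 ≤ s₂) (hs : 0 ≤ s) :
    ∫⁻ ω, ENNReal.ofReal (Real.exp (-s * X.arr 1 (X.flow (X.dep (-1) ω) ω))) *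
        X.firstCycle s₁ s₂ (X.flow (X.dep (-1) ω) ω) ∂X.palmSum =
      ENNReal.ofReal (lam * (lam / (lam + s))) * X.cycleRate s₁ s₂ := by
  have hm : Measurable fun ω => X.firstCycle s₁ s₂ (X.flow (X.dep (-1) ω) ω) :=
    (X.measurable_firstCycle s₁ s₂).comp (X.measurable_flow_dep (-1))
  have h1 := X.lintegral_one_sub_exp_mul_firstCycle hlam s₁ s₂ hs
  have h2 := X.lintegral_firstCycle hlam s₁ s₂
  have h3 : ∀ ω, X.firstCycle s₁ s₂ (X.flow (X.dep (-1) ω) ω) =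
      ENNReal.ofReal (1 - Real.exp (-s * X.arr 1 (X.flow (X.dep (-1) ω) ω))) *
        X.firstCycle s₁ s₂ (X.flow (X.dep (-1) ω) ω) +
      ENNReal.ofReal (Real.exp (-s * X.arr 1 (X.flow (X.dep (-1) ω) ω))) *
        X.firstCycle s₁ s₂ (X.flow (X.dep (-1) ω) ω) := by
    intro ω
    have hpos := X.arr_one_pos (X.flow (X.dep (-1) ω) ω)
    have h4 : Real.exp (-s * X.arr 1 (X.flow (X.dep (-1) ω) ω)) ≤ 1 := by
      rw [Real.exp_le_one_iff]; nlinarith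
    rw [← add_mul, ← ENNReal.ofReal_add (by linarith) (Real.exp_pos _).le]
    simp
  have hm1 : Measurable fun ω =>
      ENNReal.ofReal (1 - Real.exp (-s * X.arr 1 (X.flow (X.dep (-1) ω) ω))) *
        X.firstCycle s₁ s₂ (X.flow (X.dep (-1) ω) ω) := (X.measurable_one_sub_exp_idle s).mul hm
  rw [lintegral_congr h3, lintegral_add_left hm1, h1] at h2
  have hne : ENNReal.ofReal (s * (lam / (lam + s))) * X.cycleRate s₁ s₂ ≠ ∞ :=
    ENNReal.mul_ne_top ENNReal.ofReal_ne_top (X.cycleRate_ne_top hlam hθ hGpos hs₁ hs₂)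
  rw [← ENNReal.add_right_inj hne, h2, ← add_mul, ← ENNReal.ofReal_add (by positivity)
    (by positivity)]
  congr 2
  field_simp
  ring

/-- The cycle that ends at the departure `dep 0` is the first cycle seen from the preceding
departure. -/
lemma ae_firstCycle_eq (hlam : 0 < lam) (hθ : 0 ≤ θ) (s₁ s₂ : ℝ) :
    ∀ᵐ ω ∂X.palmSum, X.firstCycle s₁ s₂ (X.flow (X.dep (-1) ω) ω) =
      X.cycleEnd.indicator (fun ω => ENNReal.ofReal (Real.exp (-s₁ * (X.dep 0 ω - X.dep (-1) ω -
        X.arr 1 (X.flow (X.dep (-1) ω) ω) - X.age (X.dep 0 ω) ω)) *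
          Real.exp (-s₂ * X.age (X.dep 0 ω) ω))) ω := by
  filter_upwards [X.ae_palmSum_hasLongGaps hlam hθ] with ω hω
  have hd : X.dep 1 (X.flow (X.dep (-1) ω) ω) = X.dep 0 ω - X.dep (-1) ω := by
    rw [dep_flow_dep]; norm_num
  have hst : X.state 0 (X.flow (X.dep (-1) ω) ω) = .empty ↔ X.numLeft (-1) ω = 0 := by
    rw [state_zero_flow, numLeft, State.count_eq_zero_iff]
  have hnum : X.numLeft 1 (X.flow (X.dep (-1) ω) ω) = X.numLeft 0 ω := by
    rw [numLeft, hd, X.state_flow, sub_add_cancel, numLeft]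
  have hage : X.age (X.dep 1 (X.flow (X.dep (-1) ω) ω)) (X.flow (X.dep (-1) ω) ω) =
      X.age (X.dep 0 ω) ω := by
    rw [X.age_flow ω (fun t a => X.le_of_departsAt ω hθ hω), hd, sub_add_cancel]
  by_cases h0 : X.state 0 (X.flow (X.dep (-1) ω) ω) = .empty
  · have hω' := (X.hasLongGaps_flow ω (X.dep (-1) ω)).2 hω
    have h := X.first_departure_of_empty (X.flow (X.dep (-1) ω) ω) hθ h0
      (fun t a => X.le_of_departsAt _ hθ hω') s₁ s₂
    rw [firstCycle, indicator_of_mem (by exact h0), ← h, hnum, hage, hd]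
    by_cases h1 : X.numLeft 0 ω = 1
    · rw [if_pos h1, indicator_of_mem (show ω ∈ X.cycleEnd from ⟨hst.1 h0, h1⟩)]
    · rw [if_neg h1, indicator_of_notMem fun hc : ω ∈ X.cycleEnd => h1 hc.2]
  · rw [firstCycle, indicator_of_notMem (by exact h0),
      indicator_of_notMem fun hc : ω ∈ X.cycleEnd => h0 (hst.2 hc.1)]

lemma palmSum_cycleEnd (hlam : 0 < lam) (hθ : 0 ≤ θ) :
    X.palmSum X.cycleEnd = ENNReal.ofReal lam * X.cycleRate 0 0 := by
  rw [← X.lintegral_firstCycle hlam, lintegral_congr_ae (X.ae_firstCycle_eq hlam hθ 0 0),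
    ← lintegral_indicator_one X.measurableSet_cycleEnd]
  refine lintegral_congr fun ω => ?_
  simp [indicator]

lemma lintegral_cycleEnd_dep (hlam : 0 < lam) (hθ : 0 ≤ θ) (hGpos : G (Iic 0) = 0) {s : ℝ}
    (hs : 0 ≤ s) :
    ∫⁻ ω in X.cycleEnd, ENNReal.ofReal (Real.exp (-s * (X.dep 0 ω - X.dep (-1) ω))) ∂X.palmSum =
      ENNReal.ofReal (lam * (lam / (lam + s))) * X.cycleRate s s := by
  rw [← X.lintegral_exp_mul_firstCycle hlam hθ hGpos hs hs hs,
    ← lintegral_indicator X.measurableSet_cycleEnd]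
  refine lintegral_congr_ae ?_
  filter_upwards [X.ae_firstCycle_eq hlam hθ s s] with ω hω
  rw [hω]
  by_cases h : ω ∈ X.cycleEnd
  · rw [indicator_of_mem h, indicator_of_mem h, ← ENNReal.ofReal_mul (Real.exp_pos _).le,
      ← Real.exp_add, ← Real.exp_add]
    congr 2
    ring
  · rw [indicator_of_notMem h, indicator_of_notMem h, mul_zero]

lemma lintegral_cycleEnd_age (hlam : 0 < lam) (hθ : 0 ≤ θ) (s : ℝ) :
    ∫⁻ ω in X.cycleEnd, ENNReal.ofReal (Real.exp (-s * X.age (X.dep 0 ω) ω)) ∂X.palmSum =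
      ENNReal.ofReal lam * X.cycleRate 0 s := by
  rw [← X.lintegral_firstCycle hlam, ← lintegral_indicator X.measurableSet_cycleEnd]
  refine lintegral_congr_ae ?_
  filter_upwards [X.ae_firstCycle_eq hlam hθ 0 s] with ω hω
  rw [hω]
  simp

/-- The age of information, a supremum over uncountably many times, agrees on `cycleEnd` almost
everywhere with a measurable function of the arrivals. -/
lemma aestronglyMeasurable_exp_age (hlam : 0 < lam) (hθ : 0 ≤ θ) (s : ℝ) :
    AEStronglyMeasurable (fun ω => Real.exp (-s * X.age (X.dep 0 ω) ω))
      (X.palmSum.restrict X.cycleEnd) := by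
  have hm : Measurable fun ω => (X.firstCycle 0 s (X.flow (X.dep (-1) ω) ω)).toReal :=
    ((X.measurable_firstCycle 0 s).comp (X.measurable_flow_dep (-1))).ennreal_toReal
  refine hm.aestronglyMeasurable.congr ?_
  filter_upwards [ae_restrict_of_ae (X.ae_firstCycle_eq hlam hθ 0 s),
    ae_restrict_mem X.measurableSet_cycleEnd] with ω h1 h2
  rw [h1, indicator_of_mem (show ω ∈ X.cycleEnd from h2)]
  simp [Real.exp_nonneg]

end Palm

end StationarySystem

end AoI

theorem mainTheorem3 {Ω : Type*} [MeasurableSpace Ω] (P : Measure Ω) [IsProbabilityMeasure P]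
    (lam : ℝ) (hlam : 0 < lam)
    (G : Measure ℝ) [IsProbabilityMeasure G] (hGpos : G (Set.Iic 0) = 0)
    (hGmean : Integrable (fun x : ℝ => x) G)
    (θ : ℝ) (hθ : 0 ≤ θ) (hGθ : G (Set.Ioi θ) ≠ 0)
    (X : AoI.StationarySystem P lam G θ) :
    0 < X.palm {ω | X.numLeft (-1) ω = 0 ∧ X.numLeft 0 ω = 1} ∧
    ∀ s : ℝ, 0 ≤ s →
      (∫ ω, Real.exp (-s * (X.dep 0 ω - X.dep (-1) ω))
          ∂(ProbabilityTheory.cond X.palm {ω | X.numLeft (-1) ω = 0 ∧ X.numLeft 0 ω = 1})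
        = lam / (lam + s)
            * ((1 - AoI.preemptProb lam G θ)
                / (1 - AoI.preemptProb lam G θ * AoI.laplace (AoI.lawJ lam G θ) s))
            * AoI.laplace (AoI.lawF1 lam G θ) s) ∧
      (∫ ω, Real.exp (-s * X.age (X.dep 0 ω) ω)
          ∂(ProbabilityTheory.cond X.palm {ω | X.numLeft (-1) ω = 0 ∧ X.numLeft 0 ω = 1})
        = AoI.laplace (AoI.lawF1 lam G θ) s) := by
  have hR := X.cycleRate_ne_zero hlam hθ hGθ 0 0
  have hE0 : X.palmSum X.cycleEnd ≠ 0 := by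
    rw [X.palmSum_cycleEnd hlam hθ]
    exact mul_ne_zero (ENNReal.ofReal_pos.2 hlam).ne' hR
  have hItop := X.intensity_ne_top hlam
  have hI0 : X.intensity ≠ 0 := by
    intro h
    refine hE0 ?_
    rw [AoI.StationarySystem.intensity, ENNReal.tsum_eq_zero] at h
    have hz : X.palmSum = 0 := by
      rw [AoI.StationarySystem.palmSum, ← Measure.sum_zero]
      congr 1
      funext n
      rw [Measure.restrict_eq_zero.2 (h n), Measure.map_zero]
    simp [hz]
  have hk0 : X.intensity⁻¹ ≠ 0 := ENNReal.inv_ne_zero.2 hItop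
  have hkt : X.intensity⁻¹ ≠ ⊤ := ENNReal.inv_ne_top.2 hI0
  have hp0 : (P {ω | X.state 0 ω = .empty}).toReal ≠ 0 :=
    (ENNReal.toReal_pos (X.measure_state_eq_empty_ne_zero hlam) (measure_ne_top _ _)).ne'
  have hc0 : (AoI.successFactor (expMeasure lam) G θ 0).toReal ≠ 0 :=
    (ENNReal.toReal_pos (AoI.successFactor_ne_zero hlam hθ hGθ 0)
      (AoI.successFactor_ne_top hlam hθ le_rfl)).ne'
  have hq : 1 - AoI.preemptProb lam G θ ≠ 0 :=
    (sub_pos.2 (AoI.preemptProb_lt_one hlam hθ hGpos)).ne'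
  refine ⟨?_, fun s hs => ⟨?_, ?_⟩⟩
  · rw [X.palm_eq, Measure.smul_apply, smul_eq_mul]
    exact ENNReal.mul_pos hk0 hE0
  · have hm : Measurable fun ω => Real.exp (-s * (X.dep 0 ω - X.dep (-1) ω)) :=
      (((X.measurable_dep 0).sub (X.measurable_dep (-1))).const_mul (-s)).exp
    have hls : lam + s ≠ 0 := by positivity
    rw [X.palm_eq, AoI.cond_smul_measure _ _ hk0 hkt,
      AoI.integral_cond_eq_div _ (fun ω => (Real.exp_pos _).le) hm.aestronglyMeasurable,
      X.lintegral_cycleEnd_dep hlam hθ hGpos hs, X.palmSum_cycleEnd hlam hθ,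
      ENNReal.toReal_mul, ENNReal.toReal_mul, X.cycleRate_toReal hlam hθ hGpos s hs,
      X.cycleRate_zero_toReal hlam hθ hGpos, AoI.laplace_lawF1 hlam hθ,
      ENNReal.toReal_ofReal (by positivity), ENNReal.toReal_ofReal hlam.le]
    field_simp
  · rw [X.palm_eq, AoI.cond_smul_measure _ _ hk0 hkt,
      AoI.integral_cond_eq_div _ (fun ω => (Real.exp_pos _).le)
        (X.aestronglyMeasurable_exp_age hlam hθ s),
      X.lintegral_cycleEnd_age hlam hθ, X.palmSum_cycleEnd hlam hθ,
      ENNReal.toReal_mul, ENNReal.toReal_mul, X.cycleRate_zero_toReal hlam hθ hGpos,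
      X.cycleRate_zero_toReal hlam hθ hGpos, AoI.laplace_lawF1 hlam hθ,
      ENNReal.toReal_ofReal hlam.le]
    field_simp
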